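/- Let $0<\lambda<1$, let $d\ge 2$ be an integer and let $\rho_0$ be a constant. For each $N\ge 1$ let $G_N=(V_N,W_N,E_N)$ be a bipartite graph with a set $V_N$ of $N$ servers, a finite nonempty set $W_N$ of $M(N)$ task types, and $E_N\subseteq V_N\times W_N$. Write $\mathcal N_v=\{w:(v,w)\in E_N\}$, $\mathcal N_w=\{v:(v,w)\in E_N\}$, $d_w=|\mathcal N_w|$, and assume $d_w\ge 1$ for all $w\in W_N$. Put $$\rho(G_N)=\max_{v\in V_N}\frac{\lambda N}{M(N)}\sum_{w\in\mathcal N_v}\frac1{d_w},\qquad \phi(G_N)=\max_{v\in V_N}\Big|\frac{N}{M(N)}\sum_{w\in\mathcal N_v}\frac1{d_w}-1\Big|,\qquad \gamma(G_N)=\frac1{M(N)}\sum_{w\in W_N}\frac1{d_w}.$$ Consider the queueing system in which tasks of each type $w\in W_N$ arrive as independent Poisson processes of rate $\lambda N/M(N)$; a task of type $w$ samples $d$ servers uniformly at random with replacement from $\mathcal N_w$ and joins the shortest queue among the sampled servers, ties being broken uniformly at random; and service times are independent and exponential with mean one, each server serving its tasks one at a time in order of arrival. The vector of queue lengths $X^N(t)=(X^N_v(t))_{v\in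 V_N}$ is thus a right-continuous Markov jump process on $\{0,1,2,\dots\}^{V_N}$. Let $q_i^N(t)=\frac1N|\{v\in V_N: X^N_v(t)\ge i\}|$. Assume that $\rho(G_N)\le\rho_0$ for all $N\ge1$, that $\max\{\phi(G_N),\gamma(G_N)\}\to0$ as $N\to\infty$, and that the system starts empty, i.e. $q^N_1(0)=0$ almost surely for all $N\ge1$. Then the system of ODEs $$\frac{d\bar q_i(t)}{dt}=\lambda\big(\bar q_{i-1}(t)^d-\bar q_i(t)^d\big)-\big(\bar q_i(t)-\bar q_{i+1}(t)\big),\qquad i\ge1,\ t\ge0,$$ with $\bar q_0\equiv1$ and $\bar q_i(0)=0$ for $i\ge1$, has a unique solution $(\bar q_i)_{i\ge1}$ on $[0,\infty)$ with values in $[0,1]$, and for every fixed $t\ge0$, $$\lim_{N\to\infty}\mathbb E\Big[\sup_{s\in[0,t]}\sum_{i=1}^\infty\big(q_i^N(s)-\bar q_i(s)\big)^2\Big]=0.$$ -/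

import Mathlib

open MeasureTheory Filter Topology
open scoped NNReal ENNReal BoundedContinuousFunction

noncomputable section

/- Bipartite compatibility graphs. `V` is the set of servers, `W` the set of task types and
`E ⊆ V × W` the set of compatible pairs. -/
section Graph

variable {V W : Type*} [Fintype V] [Fintype W]

open Classical in
/-- The task types compatible with the server `v`. -/
def serverNbhd (E : Set (V × W)) (v : V) : Finset W := Finset.univ.filter fun w => (v, w) ∈ E

open Classical in
/-- The servers compatible with the task type `w`. -/
def typeNbhd {V W : Type*} [Fintype V] (E : Set (V × W)) (w : W) : Finset V := Finset.univ.filter fun v => (v, w) ∈ E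

/-- The degree of the task type `w`. -/
def typeDeg (E : Set (V × W)) (w : W) : ℕ := (typeNbhd E w).card

/-- `(N / M) ∑_{w ∈ N_v} 1 / d_w`, where `N` is the number of servers and `M` the number of
task types. -/
def serverWeight (E : Set (V × W)) (v : V) : ℝ :=
  (Fintype.card V : ℝ) / (Fintype.card W : ℝ) * ∑ w ∈ serverNbhd E v, 1 / (typeDeg E w : ℝ)

/-- `ρ(G) = max_v (lam N / M) ∑_{w ∈ N_v} 1 / d_w`. -/
def graphRho (lam : ℝ) (E : Set (V × W)) : ℝ := ⨆ v : V, lam * serverWeight E v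

/-- `φ(G) = max_v |(N / M) ∑_{w ∈ N_v} 1 / d_w - 1|`. -/
def graphPhi (E : Set (V × W)) : ℝ := ⨆ v : V, |serverWeight E v - 1|

/-- `γ(G) = (1 / M) ∑_w 1 / d_w`. -/
def graphGamma (E : Set (V × W)) : ℝ :=
  1 / (Fintype.card W : ℝ) * ∑ w : W, 1 / (typeDeg E w : ℝ)

end Graph

/-- The semigroup `e ^ (t A)` generated by a bounded operator `A`. -/
def opSemigroup {F : Type*} [NormedAddCommGroup F] [NormedSpace ℝ F] (A : F →L[ℝ] F) (t : ℝ) :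
    F →L[ℝ] F := NormedSpace.exp (t • A)

section Dynamics

variable {V W : Type*} [Fintype V] [Fintype W]

open Classical in
/-- The set of the sampled servers `s 0, …, s (d - 1)` that have the shortest queue among the
sampled servers, when the vector of queue lengths is `x`. -/
def shortestSampled {d : ℕ} (x : V → ℕ) (s : Fin d → V) : Finset V :=
  (Finset.univ.image s).filter fun v => ∀ j, x v ≤ x (s j)

open Classical in
/-- The probability that a task of type `w` that finds the queue lengths `x` joins the queue of
`v`: `d` servers are sampled uniformly with replacement from the servers compatible with `w`, and
the task joins the shortest sampled queue, ties being broken uniformly at random. -/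
def assignProb (E : Set (V × W)) (d : ℕ) (x : V → ℕ) (w : W) (v : V) : ℝ :=
  ∑ s ∈ Fintype.piFinset fun _ : Fin d => typeNbhd E w,
    (1 / (typeDeg E w : ℝ)) ^ d *
      (if v ∈ shortestSampled x s then 1 / ((shortestSampled x s).card : ℝ) else 0)

open Classical in
/-- The generator of the vector of queue lengths, applied to a function `f` at a state `x`: tasks
of each type arrive at rate `lam N / M` and are assigned by `assignProb`; each server with a
nonempty queue completes a task at rate one. -/
def generatorFun (lam : ℝ) (E : Set (V × W)) (d : ℕ) (f : (V → ℕ) → ℝ) (x : V → ℕ) : ℝ :=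
  (∑ w : W, ∑ v : V, lam * (Fintype.card V : ℝ) / (Fintype.card W : ℝ) * assignProb E d x w v *
      (f (Function.update x v (x v + 1)) - f x)) +
    ∑ v : V, if 0 < x v then f (Function.update x v (x v - 1)) - f x else 0

lemma abs_assignProb_le {V W : Type*} [Fintype V] (E : Set (V × W)) (d : ℕ) (x : V → ℕ) (w : W) (v : V) :
    |assignProb E d x w v| ≤ (typeDeg E w : ℝ) ^ d * (1 / (typeDeg E w : ℝ)) ^ d := by
  unfold assignProb
  refine (Finset.abs_sum_le_sum_abs _ _).trans ?_
  refine (Finset.sum_le_card_nsmul _ _ ((1 / (typeDeg E w : ℝ)) ^ d) ?_).trans ?_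
  · intro s _
    have h0 : (0 : ℝ) ≤ (1 / (typeDeg E w : ℝ)) ^ d := by positivity
    rw [abs_mul, abs_of_nonneg h0]
    refine mul_le_of_le_one_right h0 ?_
    split_ifs with h
    · have : (1 : ℝ) ≤ ((shortestSampled x s).card : ℝ) := by
        exact_mod_cast Finset.card_pos.mpr ⟨v, h⟩
      rw [abs_of_nonneg (by positivity)]
      exact (div_le_one (by linarith)).mpr this
    · simp
  · rw [nsmul_eq_mul, Fintype.card_piFinset_const]
    simp [typeDeg]

/-- A bound for the operator norm of the generator. -/
def generatorBound (lam : ℝ) (E : Set (V × W)) (d : ℕ) : ℝ :=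
  (∑ w : W, ∑ _v : V, |lam * (Fintype.card V : ℝ) / (Fintype.card W : ℝ)| *
      ((typeDeg E w : ℝ) ^ d * (1 / (typeDeg E w : ℝ)) ^ d) * 2) + ∑ _v : V, (2 : ℝ)

lemma abs_generatorFun_le (lam : ℝ) (E : Set (V × W)) (d : ℕ) (f : (V → ℕ) →ᵇ ℝ) (x : V → ℕ) :
    |generatorFun lam E d f x| ≤ generatorBound lam E d * ‖f‖ := by
  have key : ∀ y z : V → ℕ, |f y - f z| ≤ 2 * ‖f‖ := by
    intro y z
    have h1 := f.norm_coe_le_norm y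
    have h2 := f.norm_coe_le_norm z
    rw [Real.norm_eq_abs] at h1 h2
    exact (abs_sub _ _).trans (by linarith)
  unfold generatorFun generatorBound
  refine (abs_add_le _ _).trans ?_
  rw [add_mul]
  refine add_le_add ?_ ?_
  · rw [Finset.sum_mul]
    refine (Finset.abs_sum_le_sum_abs _ _).trans (Finset.sum_le_sum fun w _ => ?_)
    rw [Finset.sum_mul]
    refine (Finset.abs_sum_le_sum_abs _ _).trans (Finset.sum_le_sum fun v _ => ?_)
    rw [abs_mul, abs_mul, mul_assoc _ (2 : ℝ) _]
    exact mul_le_mul (mul_le_mul_of_nonneg_left (abs_assignProb_le E d x w v) (abs_nonneg _))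
      (key _ _) (abs_nonneg _) (by positivity)
  · rw [Finset.sum_mul]
    refine (Finset.abs_sum_le_sum_abs _ _).trans (Finset.sum_le_sum fun v _ => ?_)
    split_ifs
    · exact key _ _
    · simp

/-- The generator as a bounded linear operator on the bounded functions of the vector of queue
lengths. -/
def generator (lam : ℝ) (E : Set (V × W)) (d : ℕ) :
    ((V → ℕ) →ᵇ ℝ) →L[ℝ] ((V → ℕ) →ᵇ ℝ) :=
  LinearMap.mkContinuous
    { toFun := fun f => BoundedContinuousFunction.ofNormedAddCommGroupDiscrete
        (generatorFun lam E d f) (generatorBound lam E d * ‖f‖) (abs_generatorFun_le lam E d f)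
      map_add' := by
        intro f g
        ext x
        simp only [BoundedContinuousFunction.coe_ofNormedAddCommGroupDiscrete, generatorFun,
          BoundedContinuousFunction.coe_add, Pi.add_apply]
        rw [add_add_add_comm, ← Finset.sum_add_distrib, ← Finset.sum_add_distrib]
        congr 1
        · refine Finset.sum_congr rfl fun w _ => ?_
          rw [← Finset.sum_add_distrib]
          exact Finset.sum_congr rfl fun v _ => by ring
        · refine Finset.sum_congr rfl fun v _ => ?_
          split_ifs <;> ring
      map_smul' := by
        intro c f
        ext x
        simp only [BoundedContinuousFunction.coe_ofNormedAddCommGroupDiscrete, generatorFun,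
          BoundedContinuousFunction.coe_smul, smul_eq_mul, RingHom.id_apply]
        rw [mul_add, Finset.mul_sum, Finset.mul_sum]
        congr 1
        · refine Finset.sum_congr rfl fun w _ => ?_
          rw [Finset.mul_sum]
          exact Finset.sum_congr rfl fun v _ => by ring
        · refine Finset.sum_congr rfl fun v _ => ?_
          split_ifs <;> ring }
    (generatorBound lam E d)
    (by
      intro f
      refine (BoundedContinuousFunction.norm_le ?_).mpr fun x => abs_generatorFun_le lam E d f x
      have : 0 ≤ generatorBound lam E d := by unfold generatorBound; positivity
      positivity)

/-- The history up to time `s`: the σ-algebra generated by `X u`, `u ≤ s`. -/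
@[reducible] def pathHistory {Ω : Type*} (X : ℝ≥0 → Ω → V → ℕ) (s : ℝ≥0) : MeasurableSpace Ω :=
  ⨆ u : Set.Iic s, MeasurableSpace.comap (X u) inferInstance

/-- `X` is the queue length process: the right-continuous time-homogeneous Markov process whose
transition semigroup is the one generated by `generator`. -/
structure IsQueueLengthProcess {Ω : Type*} [MeasurableSpace Ω] (P : Measure Ω) (lam : ℝ)
    (E : Set (V × W)) (d : ℕ) (X : ℝ≥0 → Ω → V → ℕ) : Prop where
  measurable : ∀ t, Measurable (X t)
  rightContinuous : ∀ᵐ ω ∂P, ∀ t, ContinuousWithinAt (fun s => X s ω) (Set.Ioi t) t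
  markov : ∀ s t : ℝ≥0, s ≤ t → ∀ f : (V → ℕ) →ᵇ ℝ,
    P[fun ω => f (X t ω) | pathHistory X s] =ᵐ[P]
      fun ω => opSemigroup (generator lam E d) ((t : ℝ) - (s : ℝ)) f (X s ω)

open Classical in
/-- `q_i`: the fraction of the servers whose queue length is at least `i`. -/
def occupancy (x : V → ℕ) (i : ℕ) : ℝ :=
  ((Finset.univ.filter fun v => i ≤ x v).card : ℝ) / (Fintype.card V : ℝ)

end Dynamics

/-- `q` solves, for times `t ≥ 0`, the system
`q_i' = lam (q_{i-1} ^ d - q_i ^ d) - (q_i - q_{i+1})`, `i ≥ 1`, with `q_0 = 1`, started from the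
empty state, and takes its values in `[0, 1]`. -/
structure IsFluidSolution (lam : ℝ) (d : ℕ) (q : ℕ → ℝ → ℝ) : Prop where
  zero_eq_one : ∀ t, 0 ≤ t → q 0 t = 1
  init : ∀ i, q (i + 1) 0 = 0
  mem_Icc : ∀ i t, 0 ≤ t → q i t ∈ Set.Icc (0 : ℝ) 1
  ode : ∀ i t, 0 ≤ t → HasDerivWithinAt (q (i + 1))
    (lam * (q i t ^ d - q (i + 1) t ^ d) - (q (i + 1) t - q (i + 2) t)) (Set.Ici 0) t

end

/-! For a task type `w` let `q_i^w` be the fraction of its compatible servers holding at least `i`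
tasks (`nbhdFrac`). A task of type `w` joins a queue of length exactly `i` with probability
`(q_i^w)^d - (q_{i+1}^w)^d`. If all `q^w` agreed and every `serverWeight` were 1, the fractions
would therefore follow the fluid equations up to noise. The proof measures the failure of this by
the Lyapunov function `Φ = ∑_i 2^{-i} · mean_w (q_i^w - q̄_i)²`, truncated at level `L`
(`lyapunov`).

Along the fluid solution, `(∂_t + A) Φ ≤ κ Φ + ε` for the generator `A`
(`generatorFun_lyapunov_le`). The error `ε` collects `φ` (unequal server weights), `γ` (squared
jumps, of size `1/d_w` on average) and `2^{-L}` (truncation). The delicate term comes from the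
arrival rate at a server, which depends on the fractions of all types compatible with it, so the
deviation of one type is driven by those of types two edges away. After averaging over types this
two-step operator is bounded by `ρ` (`sum_weightedSum_le`), so no expansion or regularity of the
graph beyond `φ`, `γ` and `ρ` is needed.

Consequently `e^{-κ t} Φ + ε (T - t)` is a supermartingale, and Doob's maximal inequality
(`IsSupersolution.maximal`) makes `sup_{s ≤ T} Φ` small in probability. The global occupancy is
within `φ` of the mean of `q_i^w` (`abs_mean_nbhdFrac_sub_occupancy_le`), which settles any fixed
number of levels.

The remaining levels are controlled by the number of tasks per server: `q_i ≤ load / i`, and an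
exponential supermartingale bounds `E sup load²` uniformly in `N`. The fluid solution inherits a
bound `A / i` in the limit. Squares of both are summable in `i`, so the tail is uniformly small in
expectation. -/

section AbstractSemigroup

/-! ### Semigroups of bounded operators and invariant cones. -/

variable {F : Type*} [NormedAddCommGroup F] [NormedSpace ℝ F]

lemma opSemigroup_zero (A : F →L[ℝ] F) : opSemigroup A 0 = 1 := by
  simp [opSemigroup, NormedSpace.exp_zero]

variable [CompleteSpace F]

lemma hasDerivAt_opSemigroup (A : F →L[ℝ] F) (t : ℝ) :
    HasDerivAt (opSemigroup A) (opSemigroup A t * A) t :=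
  hasDerivAt_exp_smul_const (𝕂 := ℝ) A t

lemma continuous_opSemigroup (A : F →L[ℝ] F) : Continuous (opSemigroup A) :=
  continuous_iff_continuousAt.2 fun t => (hasDerivAt_opSemigroup A t).continuousAt

lemma hasDerivAt_opSemigroup_apply (A : F →L[ℝ] F) (s : ℝ) {Z : ℝ → F} {Z' : F} {u : ℝ}
    (hZ : HasDerivAt Z Z' u) :
    HasDerivAt (fun u => opSemigroup A (u - s) (Z u)) (opSemigroup A (u - s) (A (Z u) + Z')) u := by
  have h0 : HasDerivAt (fun u => opSemigroup A (u - s)) (opSemigroup A (u - s) * A) u := by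
    simpa [Function.comp_def] using
      (hasDerivAt_opSemigroup A (u - s)).scomp u ((hasDerivAt_id u).sub_const s)
  simpa using h0.clm_apply hZ

/-- If `A + c` preserves a cone, so does the semigroup generated by `A`. -/
lemma apply_opSemigroup_nonneg (A : F →L[ℝ] F) (c : ℝ) (K : Set F)
    (hK : ∀ g ∈ K, A g + c • g ∈ K) (hK' : ∀ g ∈ K, ∀ r : ℝ, 0 ≤ r → r • g ∈ K) {t : ℝ}
    (ht : 0 ≤ t) (ℓ : F →L[ℝ] ℝ) (hℓ : ∀ g ∈ K, 0 ≤ ℓ g) {f : F} (hf : f ∈ K) :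
    0 ≤ ℓ (opSemigroup A t f) := by
  -- Scalars commute with `A`, so `exp (t A) = e^{-tc} exp B`, and every power of `B` maps `K` into
  -- itself. Applying `ℓ` to the exponential series term by term means that `K` need be neither
  -- closed nor stable under addition.
  set B : F →L[ℝ] F := t • (A + c • 1) with hB
  have hpow : ∀ n : ℕ, (B ^ n) f ∈ K := by
    intro n
    induction n with
    | zero => simpa using hf
    | succ k ih =>
      rw [pow_succ']
      exact hK' _ (hK _ ih) t ht
  have hexpB : 0 ≤ ℓ (NormedSpace.exp B f) := by
    have hs := NormedSpace.exp_series_hasSum_exp' (𝕂 := ℝ) B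
    have hs2 := (hs.mapL (ContinuousLinearMap.apply ℝ F f)).mapL ℓ
    refine hs2.nonneg fun n => ?_
    have : ℓ ((ContinuousLinearMap.apply ℝ F f) ((n.factorial : ℝ)⁻¹ • B ^ n))
        = (n.factorial : ℝ)⁻¹ * ℓ ((B ^ n) f) := by simp
    rw [this]
    exact mul_nonneg (by positivity) (hℓ _ (hpow n))
  have hsplit : t • A = algebraMap ℝ (F →L[ℝ] F) (-(t * c)) + B := by
    rw [hB, Algebra.algebraMap_eq_smul_one, smul_add, smul_smul, neg_smul (t * c) (1 : F →L[ℝ] F)]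
    abel
  unfold opSemigroup
  let _ : NormedAlgebra ℚ (F →L[ℝ] F) := NormedAlgebra.restrictScalars ℚ ℝ _
  rw [hsplit, NormedSpace.exp_add_of_commute (Algebra.commutes _ _),
    ← NormedSpace.algebraMap_exp_comm, ← Real.exp_eq_exp_ℝ, Algebra.algebraMap_eq_smul_one]
  have : ℓ (((Real.exp (-(t * c)) • (1 : F →L[ℝ] F)) * NormedSpace.exp B) f)
      = Real.exp (-(t * c)) * ℓ (NormedSpace.exp B f) := by
    simp
  rw [this]
  positivity

end AbstractSemigroup

/-! ### Positivity of the queueing semigroup and comparison with supersolutions. -/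

section Semigroup

variable {V W : Type*} [Fintype V] [Fintype W]

lemma assignProb_nonneg {V W : Type*} [Fintype V] (E : Set (V × W)) (d : ℕ) (x : V → ℕ) (w : W) (v : V) :
    0 ≤ assignProb E d x w v := by
  unfold assignProb
  refine Finset.sum_nonneg fun s _ => mul_nonneg (by positivity) ?_
  split_ifs <;> positivity

lemma generator_apply (lam : ℝ) (E : Set (V × W)) (d : ℕ) (f : (V → ℕ) →ᵇ ℝ) (x : V → ℕ) :
    generator lam E d f x = generatorFun lam E d f x := rfl

lemma generatorBound_nonneg (lam : ℝ) (E : Set (V × W)) (d : ℕ) :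
    0 ≤ generatorBound lam E d := by
  unfold generatorBound; positivity

-- The terms `f (update …)` are nonnegative and can be dropped; what is left is `-f x` times the
-- total jump rate, which `generatorBound` dominates. Hence `A + generatorBound` preserves
-- nonnegative functions, the hypothesis of `apply_opSemigroup_nonneg`.
open scoped Classical in
lemma neg_le_generatorFun {lam : ℝ} (hlam : 0 ≤ lam) (E : Set (V × W)) (d : ℕ)
    (f : (V → ℕ) → ℝ) (hf : ∀ x, 0 ≤ f x) (x : V → ℕ) :
    -(generatorBound lam E d * f x) ≤ generatorFun lam E d f x := by
  unfold generatorFun generatorBound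
  rw [add_mul, neg_add, Finset.sum_mul, Finset.sum_mul, ← Finset.sum_neg_distrib,
    ← Finset.sum_neg_distrib]
  refine add_le_add (Finset.sum_le_sum fun w _ => ?_) (Finset.sum_le_sum fun v _ => ?_)
  · rw [Finset.sum_mul, ← Finset.sum_neg_distrib]
    refine Finset.sum_le_sum fun v _ => ?_
    have h1 : 0 ≤ lam * (Fintype.card V : ℝ) / (Fintype.card W : ℝ) := by positivity
    rw [abs_of_nonneg h1]
    have h2 := abs_assignProb_le E d x w v
    rw [abs_of_nonneg (assignProb_nonneg E d x w v)] at h2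
    have h3 := assignProb_nonneg E d x w v
    have h4 := mul_le_mul_of_nonneg_left h2 h1
    have h5 := mul_nonneg h1 h3
    have h6 := mul_nonneg h5 (hf (Function.update x v (x v + 1)))
    have h7 := mul_le_mul_of_nonneg_right h4 (hf x)
    have h8 := mul_nonneg h5 (hf x)
    nlinarith
  · have := hf x
    have := hf (Function.update x v (x v - 1))
    split_ifs <;> linarith

lemma opSemigroup_nonneg {lam : ℝ} (hlam : 0 ≤ lam) (E : Set (V × W)) (d : ℕ) {t : ℝ}
    (ht : 0 ≤ t) (f : (V → ℕ) →ᵇ ℝ) (hf : ∀ x, 0 ≤ f x) (x : V → ℕ) :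
    0 ≤ opSemigroup (generator lam E d) t f x := by
  have hc := generatorBound_nonneg lam E d
  refine apply_opSemigroup_nonneg (generator lam E d) (generatorBound lam E d)
    {g : (V → ℕ) →ᵇ ℝ | ∀ y, 0 ≤ g y} (fun g hg y => ?_) (fun g hg r hr y => ?_) ht
    (BoundedContinuousFunction.evalCLM ℝ x) (fun g hg => hg x) hf
  · have := neg_le_generatorFun hlam E d g hg y
    simp only [BoundedContinuousFunction.coe_add, BoundedContinuousFunction.coe_smul,
      Pi.add_apply, generator_apply, smul_eq_mul]
    linarith
  · exact mul_nonneg hr (hg y)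

/-- A time-dependent function `Z` with `∂Z/∂t + A Z ≤ 0` on `[0, T]`, where `A` is the generator,
is a supersolution: the semigroup decreases it. -/
lemma opSemigroup_le_of_deriv_add_generator_nonpos {lam : ℝ} (hlam : 0 ≤ lam) (E : Set (V × W))
    (d : ℕ) {T : ℝ} (Z Z' : ℝ → (V → ℕ) →ᵇ ℝ) (hcont : ContinuousOn Z (Set.Icc 0 T))
    (hderiv : ∀ u ∈ Set.Ioo 0 T, HasDerivAt Z (Z' u) u)
    (hle : ∀ u ∈ Set.Ioo 0 T, ∀ x, Z' u x + generatorFun lam E d (Z u) x ≤ 0)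
    {s t : ℝ} (hs : 0 ≤ s) (hst : s ≤ t) (ht : t ≤ T) (x : V → ℕ) :
    opSemigroup (generator lam E d) (t - s) (Z t) x ≤ Z s x := by
  set A := generator lam E d with hA
  -- This interpolates between `Z s x` at `u = s` and the left-hand side at `u = t`. Its derivative
  -- is the semigroup applied to `A Z + Z' ≤ 0`, hence nonpositive by positivity of the semigroup.
  set φ : ℝ → ℝ := fun u => BoundedContinuousFunction.evalCLM ℝ x (opSemigroup A (u - s) (Z u))
    with hφ
  have hφd : ∀ u ∈ Set.Ioo s t, HasDerivAt φ
      (BoundedContinuousFunction.evalCLM ℝ x (opSemigroup A (u - s) (A (Z u) + Z' u))) u := by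
    intro u hu
    have h1 := hasDerivAt_opSemigroup_apply A s (hderiv u ⟨by linarith [hu.1], by linarith [hu.2]⟩)
    exact (BoundedContinuousFunction.evalCLM ℝ x).hasFDerivAt.comp_hasDerivAt u h1
  have hanti : AntitoneOn φ (Set.Icc s t) := by
    refine antitoneOn_of_deriv_nonpos (convex_Icc s t) ?_ ?_ ?_
    · have h1 : ContinuousOn (fun u => opSemigroup A (u - s)) (Set.Icc s t) :=
        ((continuous_opSemigroup A).comp (continuous_id.sub continuous_const)).continuousOn
      have h2 := h1.clm_apply (hcont.mono (Set.Icc_subset_Icc hs ht))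
      exact (BoundedContinuousFunction.evalCLM ℝ x).continuous.comp_continuousOn h2
    · rw [interior_Icc]
      exact fun u hu => (hφd u hu).differentiableAt.differentiableWithinAt
    · rw [interior_Icc]
      intro u hu
      rw [(hφd u hu).deriv]
      have h1 := opSemigroup_nonneg hlam E d (t := u - s) (by linarith [hu.1])
        (-(A (Z u) + Z' u)) (fun y => by
          have := hle u ⟨by linarith [hu.1], by linarith [hu.2]⟩ y
          simp only [BoundedContinuousFunction.coe_neg, BoundedContinuousFunction.coe_add,
            Pi.neg_apply, Pi.add_apply, hA, generator_apply]
          linarith) x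
      rw [map_neg] at h1
      exact neg_nonneg.1 h1
  have := hanti (Set.left_mem_Icc.2 hst) (Set.right_mem_Icc.2 hst) hst
  simpa only [hφ, sub_self, opSemigroup_zero, BoundedContinuousFunction.evalCLM_apply,
    one_apply_eq_self] using this

end Semigroup

/-! ### Supermartingales and Doob's maximal inequality. -/

section Maximal

variable {V W : Type*} [Fintype V] [Fintype W] {Ω : Type*} [MeasurableSpace Ω] {P : Measure Ω}
  {lam : ℝ} {E : Set (V × W)} {d : ℕ} {X : ℝ≥0 → Ω → V → ℕ}

lemma pathHistory_le (hX : IsQueueLengthProcess P lam E d X) (s : ℝ≥0) :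
    pathHistory X s ≤ (inferInstance : MeasurableSpace Ω) :=
  iSup_le fun u => (hX.measurable u).comap_le

lemma measurable_pathHistory {V Ω : Type*} (X : ℝ≥0 → Ω → V → ℕ) {s u : ℝ≥0} (h : u ≤ s) :
    Measurable[pathHistory X s] (X u) := by
  have : MeasurableSpace.comap (X u) inferInstance ≤ pathHistory X s :=
    le_iSup (fun u : Set.Iic s => MeasurableSpace.comap (X u) inferInstance) ⟨u, h⟩
  exact fun S hS => this _ ⟨S, hS, rfl⟩

/-- `Z` decreases along the semigroup on `[0, T]`. -/
def IsSupersolution (lam : ℝ) (E : Set (V × W)) (d : ℕ) (T : ℝ≥0)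
    (Z : ℝ → (V → ℕ) →ᵇ ℝ) : Prop :=
  ∀ s t : ℝ, 0 ≤ s → s ≤ t → t ≤ T → ∀ x,
    opSemigroup (generator lam E d) (t - s) (Z t) x ≤ Z s x

variable [IsProbabilityMeasure P]

lemma integrable_comp_process (hX : IsQueueLengthProcess P lam E d X) (t : ℝ≥0)
    (f : (V → ℕ) →ᵇ ℝ) : Integrable (fun ω => f (X t ω)) P := by
  refine Integrable.of_bound
    ((measurable_of_countable f).comp (hX.measurable t)).aestronglyMeasurable
    ‖f‖ (ae_of_all _ fun ω => f.norm_coe_le_norm _)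

/-- The supermartingale property of `Z t (X t)` with respect to the path history: by the Markov
property the conditional expectation is the semigroup applied to `Z t`, which is at most `Z s`. -/
lemma IsSupersolution.setIntegral_le {T : ℝ≥0} {Z : ℝ → (V → ℕ) →ᵇ ℝ}
    (hZ : IsSupersolution lam E d T Z) (hX : IsQueueLengthProcess P lam E d X) {s t : ℝ≥0}
    (hst : s ≤ t) (ht : t ≤ T) {S : Set Ω} (hS : MeasurableSet[pathHistory X s] S) :
    ∫ ω in S, Z t (X t ω) ∂P ≤ ∫ ω in S, Z s (X s ω) ∂P := by
  rw [← setIntegral_condExp (pathHistory_le hX s) (integrable_comp_process hX t (Z t)) hS]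
  have h1 := hX.markov s t hst (Z t)
  refine setIntegral_mono_ae integrable_condExp.integrableOn
    (integrable_comp_process hX s (Z s)).integrableOn ?_
  filter_upwards [h1] with ω hω
  rw [hω]
  exact hZ s t s.2 (by exact_mod_cast hst) (by exact_mod_cast ht) _

lemma measurableSet_forall_lt {V Ω : Type*} [Fintype V] {X : ℝ≥0 → Ω → V → ℕ} {a : ℝ} (Z : ℝ → (V → ℕ) →ᵇ ℝ) (F : Finset ℝ≥0) {s : ℝ≥0}
    (hF : ∀ u ∈ F, u ≤ s) :
    MeasurableSet[pathHistory X s] {ω | ∀ u ∈ F, Z u (X u ω) < a} := by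
  have : {ω | ∀ u ∈ F, Z u (X u ω) < a} = ⋂ u ∈ F, {ω | Z u (X u ω) < a} := by
    ext ω; simp
  rw [this]
  refine Finset.measurableSet_biInter _ fun u hu => ?_
  have h2 : Measurable[pathHistory X s] fun ω => Z u (X u ω) :=
    (measurable_of_countable (Z u)).comp (measurable_pathHistory X (hF u hu))
  exact h2 measurableSet_Iio

/-- Doob's inequality on finitely many times, by peeling off the latest time `m`. The integral over
the event of no exceedance is retained because the next step splits it at time `m`: where `Z m ≥ a`
it pays for the new probability, elsewhere it decreases from `m` to `t`. -/
lemma IsSupersolution.maximal_finset {T : ℝ≥0} {Z : ℝ → (V → ℕ) →ᵇ ℝ}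
    (hZ : IsSupersolution lam E d T Z) (hX : IsQueueLengthProcess P lam E d X) (a : ℝ)
    (F : Finset ℝ≥0) : ∀ t ≤ T, (∀ u ∈ F, u ≤ t) →
      a * P.real {ω | ∀ u ∈ F, Z u (X u ω) < a}ᶜ +
        ∫ ω in {ω | ∀ u ∈ F, Z u (X u ω) < a}, Z t (X t ω) ∂P ≤ ∫ ω, Z 0 (X 0 ω) ∂P := by
  classical
  induction F using Finset.induction_on_max with
  | empty =>
    intro t ht _
    have := hZ.setIntegral_le hX zero_le ht MeasurableSet.univ
    simpa using this
  | insert m F hm ih =>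
    intro t ht hF
    have hmt : m ≤ t := hF m (Finset.mem_insert_self _ _)
    set S := {ω | ∀ u ∈ F, Z u (X u ω) < a} with hS
    set B := {ω | Z m (X m ω) < a} with hB
    have hSI : {ω | ∀ u ∈ insert m F, Z u (X u ω) < a} = S ∩ B := by
      ext ω
      simp [hS, hB, and_comm]
    have hSm : MeasurableSet[pathHistory X m] S := measurableSet_forall_lt Z F fun u hu => (hm u hu).le
    have hBm : MeasurableSet[pathHistory X m] B := by
      have := measurableSet_forall_lt (X := X) (a := a) Z {m} (s := m) (by simp)
      simpa [hB] using this
    have hS0 := pathHistory_le hX m _ hSm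
    have hB0 := pathHistory_le hX m _ hBm
    have h1 := ih m (hmt.trans ht) fun u hu => (hm u hu).le
    have h2 := hZ.setIntegral_le hX hmt ht (hSm.inter hBm)
    have h3 : ∫ ω in S, Z m (X m ω) ∂P =
        ∫ ω in S ∩ B, Z m (X m ω) ∂P + ∫ ω in S \ B, Z m (X m ω) ∂P :=
      (integral_inter_add_sdiff hB0 (integrable_comp_process hX m (Z m)).integrableOn).symm
    have h4 : a * P.real (S \ B) ≤ ∫ ω in S \ B, Z m (X m ω) ∂P := by
      have := setIntegral_ge_of_const_le_real (hS0.diff hB0) (measure_ne_top P _)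
        (fun ω hω => not_lt.1 hω.2) (integrable_comp_process hX m (Z m)).integrableOn
      linarith
    have h5 : P.real (S ∩ B)ᶜ = P.real Sᶜ + P.real (S \ B) := by
      have h6 : (S ∩ B)ᶜ = Sᶜ ∪ S \ B := by
        ext ω
        simp only [Set.mem_compl_iff, Set.mem_inter_iff, Set.mem_union, Set.mem_sdiff]
        tauto
      have h7 : Disjoint Sᶜ (S \ B) := disjoint_compl_left.mono_right Set.sdiff_subset
      rw [h6, measureReal_union h7 (hS0.diff hB0)]
    rw [hSI, h5]
    linarith

/-- Maximal inequality for nonnegative supersolutions. -/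
lemma IsSupersolution.maximal {T : ℝ≥0} {Z : ℝ → (V → ℕ) →ᵇ ℝ}
    (hZ : IsSupersolution lam E d T Z) (hX : IsQueueLengthProcess P lam E d X)
    (hnonneg : ∀ s ∈ Set.Icc (0 : ℝ) T, ∀ x, 0 ≤ Z s x)
    (hcont : ∀ x, ContinuousOn (fun s => Z s x) (Set.Icc 0 T)) {a : ℝ} (ha : 0 < a) :
    P {ω | ∃ s ≤ T, a < Z s (X s ω)} ≤ ENNReal.ofReal ((∫ ω, Z 0 (X 0 ω) ∂P) / a) := by
  classical
  -- The supremum is reduced to countably many times. The state space is discrete, so a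
  -- right-continuous path is constant just after `s`, and an exceedance at `s < T` is also seen at
  -- a nearby point of `D`. The time `T` has no later times in the interval and is added by hand.
  obtain ⟨D, hDc, hDd⟩ := TopologicalSpace.exists_countable_dense ℝ≥0
  obtain ⟨D', hD'⟩ : ∃ D' : Set ℝ≥0, D' = insert T (D ∩ Set.Iic T) := ⟨_, rfl⟩
  have hD'c : D'.Countable := by rw [hD']; exact (hDc.mono Set.inter_subset_left).insert T
  have hD'T : ∀ u ∈ D', u ≤ T := by
    rw [hD']
    rintro u (rfl | hu)
    · exact le_rfl
    · exact hu.2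
  obtain ⟨e, he⟩ := hD'c.exists_eq_range ⟨T, by rw [hD']; exact Set.mem_insert _ _⟩
  set B : ℕ → Set Ω := fun n => {ω | ∀ u ∈ (Finset.range n).image e, Z u (X u ω) < a}ᶜ with hB
  have hsub : {ω | ∃ s ≤ T, a < Z s (X s ω)} ≤ᵐ[P] ⋃ n, B n := by
    filter_upwards [hX.rightContinuous] with ω hω
    rintro ⟨s, hsT, hs⟩
    obtain ⟨u, hu, hau⟩ : ∃ u ∈ D', a < Z u (X u ω) := by
      rcases hsT.eq_or_lt with rfl | hlt
      · exact ⟨s, by rw [hD']; exact Set.mem_insert _ _, hs⟩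
      · have hev : ∀ᶠ u : ℝ≥0 in 𝓝[>] s, X u ω = X s ω := by
          have h1 := hω s
          unfold ContinuousWithinAt at h1
          rw [nhds_discrete, tendsto_pure] at h1
          exact h1
        have hev2 : ∀ᶠ u : ℝ≥0 in 𝓝[>] s, a < Z u (X s ω) := by
          have h2 : ContinuousWithinAt (fun u : ℝ≥0 => Z u (X s ω)) (Set.Icc 0 T) s := by
            refine ContinuousWithinAt.comp (f := fun u : ℝ≥0 => (u : ℝ))
              (g := fun r => Z r (X s ω)) (t := Set.Icc (0 : ℝ) T)
              (hcont _ _ ⟨s.2, by exact_mod_cast hsT⟩)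
              NNReal.continuous_coe.continuousWithinAt fun u hu => ⟨u.2, by exact_mod_cast hu.2⟩
          have h3 := h2.eventually (lt_mem_nhds hs)
          refine h3.filter_mono (nhdsWithin_le_iff.2 ?_)
          exact mem_of_superset (Ioc_mem_nhdsGT hlt) fun u hu => ⟨zero_le, hu.2⟩
        obtain ⟨b, hb, hbsub⟩ := (mem_nhdsGT_iff_exists_Ioo_subset' hlt).1 ((hev.and hev2).and
          (Ioc_mem_nhdsGT hlt))
        obtain ⟨u, hu1, hu2⟩ := hDd.exists_mem_open isOpen_Ioo (Set.nonempty_Ioo.2 hb)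
        have hu3 := hbsub hu2
        refine ⟨u, by rw [hD']; exact Or.inr ⟨hu1, hu3.2.2⟩, ?_⟩
        have h4 := hu3.1
        rw [h4.1]
        exact h4.2
    rw [he] at hu
    obtain ⟨n, rfl⟩ := hu
    refine Set.mem_iUnion.2 ⟨n + 1, fun h => ?_⟩
    exact absurd (h (e n) (Finset.mem_image_of_mem _ (by simp))) (not_lt.2 hau.le)
  refine (measure_mono_ae hsub).trans ?_
  have hmono : Monotone B := by
    intro m n hmn ω h1 h2
    exact h1 fun u hu => h2 u (Finset.image_subset_image (Finset.range_mono hmn) hu)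
  rw [hmono.directed_le.measure_iUnion]
  refine iSup_le fun n => ?_
  have hFT : ∀ u ∈ (Finset.range n).image e, u ≤ T := by
    intro u hu
    obtain ⟨k, -, rfl⟩ := Finset.mem_image.1 hu
    exact hD'T _ (by rw [he]; exact Set.mem_range_self k)
  have h1 := hZ.maximal_finset hX a ((Finset.range n).image e) T le_rfl hFT
  have h2 : 0 ≤ ∫ ω in {ω | ∀ u ∈ (Finset.range n).image e, Z u (X u ω) < a}, Z T (X T ω) ∂P :=
    integral_nonneg fun ω => hnonneg T ⟨T.2, le_rfl⟩ _
  rw [← ENNReal.ofReal_toReal (measure_ne_top P (B n))]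
  refine ENNReal.ofReal_le_ofReal ((le_div_iff₀ ha).2 ?_)
  have h3 : (P (B n)).toReal = P.real (B n) := rfl
  rw [h3, mul_comm]
  linarith

end Maximal

/-! ### Existence and uniqueness for the fluid equations. -/

section Fluid

/-- The drift of the fluid limit. -/
def fluidDrift (lam : ℝ) (d : ℕ) (a b c : ℝ) : ℝ := lam * (a ^ d - b ^ d) - (b - c)

lemma abs_pow_sub_pow_le_of_mem_Icc {a b : ℝ} (ha : a ∈ Set.Icc (0 : ℝ) 1)
    (hb : b ∈ Set.Icc (0 : ℝ) 1) (d : ℕ) : |a ^ d - b ^ d| ≤ d * |a - b| := by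
  have h1 := abs_pow_sub_pow_le a b d
  have h2 : max |a| |b| ^ (d - 1) ≤ 1 := by
    refine pow_le_one₀ (by positivity) (max_le ?_ ?_)
    · rw [abs_of_nonneg ha.1]; exact ha.2
    · rw [abs_of_nonneg hb.1]; exact hb.2
  calc _ ≤ _ := h1
    _ ≤ |a - b| * d * 1 := by gcongr
    _ = _ := by ring

lemma abs_fluidDrift_sub_le {lam : ℝ} (hlam : 0 ≤ lam) (d : ℕ) {a b c a' b' c' δ : ℝ}
    (ha : a ∈ Set.Icc (0 : ℝ) 1) (hb : b ∈ Set.Icc (0 : ℝ) 1)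
    (ha' : a' ∈ Set.Icc (0 : ℝ) 1) (hb' : b' ∈ Set.Icc (0 : ℝ) 1)
    (h1 : |a - a'| ≤ δ) (h2 : |b - b'| ≤ δ) (h3 : |c - c'| ≤ δ) :
    |fluidDrift lam d a b c - fluidDrift lam d a' b' c'| ≤ (2 * lam * d + 2) * δ := by
  have e1 := (abs_pow_sub_pow_le_of_mem_Icc ha ha' d).trans
    (mul_le_mul_of_nonneg_left h1 d.cast_nonneg)
  have e2 := (abs_pow_sub_pow_le_of_mem_Icc hb hb' d).trans
    (mul_le_mul_of_nonneg_left h2 d.cast_nonneg)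
  have e3 : fluidDrift lam d a b c - fluidDrift lam d a' b' c' =
      lam * ((a ^ d - a' ^ d) - (b ^ d - b' ^ d)) - ((b - b') - (c - c')) := by
    unfold fluidDrift; ring
  have e4 : |lam * ((a ^ d - a' ^ d) - (b ^ d - b' ^ d))| ≤ lam * (d * δ + d * δ) := by
    rw [abs_mul, abs_of_nonneg hlam]
    exact mul_le_mul_of_nonneg_left ((abs_sub _ _).trans (add_le_add e1 e2)) hlam
  rw [e3]
  calc _ ≤ _ := abs_sub _ _
    _ ≤ lam * (d * δ + d * δ) + (δ + δ) :=
      add_le_add e4 ((abs_sub _ _).trans (add_le_add h2 h3))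
    _ = _ := by ring

/-- A function with nonpositive derivative wherever it is positive stays nonpositive. -/
lemma nonpos_of_deriv_nonpos_of_pos {f f' : ℝ → ℝ} {T : ℝ} (hf : ContinuousOn f (Set.Icc 0 T))
    (hf' : ∀ t ∈ Set.Ico 0 T, HasDerivWithinAt f (f' t) (Set.Ici t) t) (h0 : f 0 ≤ 0)
    (hpos : ∀ t ∈ Set.Ico 0 T, 0 < f t → f' t ≤ 0) {t : ℝ} (ht : t ∈ Set.Icc 0 T) : f t ≤ 0 := by
  refine le_of_forall_pos_le_add fun ε hε => ?_
  have hT : 0 ≤ T := ht.1.trans ht.2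
  -- A positive barrier of positive slope that stays below `ε`: where `f` touches it, `f` is
  -- positive and so has nonpositive derivative, and cannot cross.
  have key := image_le_of_deriv_right_lt_deriv_boundary (B := fun s => ε / (1 + T) * (1 + s))
    (B' := fun _ => ε / (1 + T)) hf hf' (by have : 0 ≤ ε / (1 + T) := by positivity
                                            simp; linarith)
    (fun x => by simpa using ((hasDerivAt_id x).const_add 1).const_mul (ε / (1 + T)))
    (fun x hx hxe => by
      have h1 : 0 < ε / (1 + T) := by positivity
      refine (hpos x hx ?_).trans_lt h1
      rw [hxe]
      have := hx.1
      positivity) ht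
  refine key.trans ?_
  rw [zero_add, div_mul_eq_mul_div, div_le_iff₀ (by positivity)]
  have := ht.2
  gcongr

/-- `q` solves the fluid equations on `[0, T]` started from the empty state. -/
structure IsFluidSolutionUpTo (lam : ℝ) (d : ℕ) (T : ℝ) (q : ℕ → ℝ → ℝ) : Prop where
  zero_eq_one : ∀ t ∈ Set.Icc 0 T, q 0 t = 1
  init : ∀ i, q (i + 1) 0 = 0
  mem_Icc : ∀ i, ∀ t ∈ Set.Icc 0 T, q i t ∈ Set.Icc (0 : ℝ) 1
  ode : ∀ i, ∀ t ∈ Set.Icc 0 T, HasDerivWithinAt (q (i + 1))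
    (fluidDrift lam d (q i t) (q (i + 1) t) (q (i + 2) t)) (Set.Icc 0 T) t

lemma IsFluidSolution.upTo {lam : ℝ} {d : ℕ} {q : ℕ → ℝ → ℝ} (h : IsFluidSolution lam d q)
    (T : ℝ) : IsFluidSolutionUpTo lam d T q where
  zero_eq_one t ht := h.zero_eq_one t ht.1
  init := h.init
  mem_Icc i t ht := h.mem_Icc i t ht.1
  ode i t ht := (h.ode i t ht.1).mono Set.Icc_subset_Ici_self

lemma IsFluidSolutionUpTo.mono {lam : ℝ} {d : ℕ} {q : ℕ → ℝ → ℝ} {T T' : ℝ}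
    (h : IsFluidSolutionUpTo lam d T q) (hT : T' ≤ T) : IsFluidSolutionUpTo lam d T' q :=
  have hs : Set.Icc 0 T' ⊆ Set.Icc 0 T := Set.Icc_subset_Icc_right hT
  { zero_eq_one := fun t ht => h.zero_eq_one t (hs ht)
    init := h.init
    mem_Icc := fun i t ht => h.mem_Icc i t (hs ht)
    ode := fun i t ht => (h.ode i t (hs ht)).mono hs }

lemma hasDerivWithinAt_Ici_of_Icc {f : ℝ → ℝ} {f' T t : ℝ} (ht : t ∈ Set.Ico 0 T)
    (h : HasDerivWithinAt f f' (Set.Icc 0 T) t) : HasDerivWithinAt f f' (Set.Ici t) t :=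
  h.mono_of_mem_nhdsWithin
    (mem_of_superset (Icc_mem_nhdsGE ht.2) (Set.Icc_subset_Icc_left ht.1))

/-- The drift is Lipschitz in the supremum norm over levels, so Picard iteration improves the
trivial bound 1 on the difference to `(C t)^n / n!` for every `n`, at all levels at once. No decay
in the level is required of the solutions. -/
lemma IsFluidSolutionUpTo.unique {lam : ℝ} (hlam : 0 ≤ lam) {d : ℕ} {p q : ℕ → ℝ → ℝ} {T : ℝ}
    (hp : IsFluidSolutionUpTo lam d T p) (hq : IsFluidSolutionUpTo lam d T q) (i : ℕ) {t : ℝ}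
    (ht : t ∈ Set.Icc 0 T) : p i t = q i t := by
  set C : ℝ := 2 * lam * d + 2 with hC
  have hC0 : 0 ≤ C := by positivity
  have key : ∀ n : ℕ, ∀ i, ∀ s ∈ Set.Icc 0 T, |p i s - q i s| ≤ (C * s) ^ n / n.factorial := by
    intro n
    induction n with
    | zero =>
      intro i s hs
      have h1 := hp.mem_Icc i s hs
      have h2 := hq.mem_Icc i s hs
      simp only [pow_zero, Nat.factorial_zero, Nat.cast_one, div_one]
      exact abs_le.2 ⟨by linarith [h1.1, h2.2], by linarith [h1.2, h2.1]⟩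
    | succ n ih =>
      intro i s hs
      cases i with
      | zero =>
        rw [hp.zero_eq_one s hs, hq.zero_eq_one s hs, sub_self, abs_zero]
        have := hs.1
        positivity
      | succ i =>
        refine image_norm_le_of_norm_deriv_right_le_deriv_boundary
          (f := fun s => p (i + 1) s - q (i + 1) s)
          (f' := fun s => fluidDrift lam d (p i s) (p (i + 1) s) (p (i + 2) s) -
            fluidDrift lam d (q i s) (q (i + 1) s) (q (i + 2) s))
          (B := fun s => (C * s) ^ (n + 1) / (n + 1).factorial)
          (B' := fun s => C * ((C * s) ^ n / n.factorial))
          (a := 0) (b := T) ?_ ?_ ?_ ?_ ?_ hs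
        · exact fun u hu => ((hp.ode i u hu).sub (hq.ode i u hu)).continuousWithinAt
        · exact fun u hu => hasDerivWithinAt_Ici_of_Icc hu
            ((hp.ode i u (Set.Ico_subset_Icc_self hu)).sub
              (hq.ode i u (Set.Ico_subset_Icc_self hu)))
        · simp [hp.init, hq.init]
        · intro x
          have h1 := (((hasDerivAt_id x).const_mul C).pow (n + 1)).div_const
            ((n + 1).factorial : ℝ)
          refine h1.congr_deriv ?_
          rw [Nat.factorial_succ]
          push_cast
          have : (n.factorial : ℝ) ≠ 0 := by positivity
          have : (n : ℝ) + 1 ≠ 0 := by positivity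
          simp only [id]
          field_simp
        · intro u hu
          have hu' := Set.Ico_subset_Icc_self hu
          exact abs_fluidDrift_sub_le hlam d (hp.mem_Icc _ _ hu') (hp.mem_Icc _ _ hu')
            (hq.mem_Icc _ _ hu') (hq.mem_Icc _ _ hu') (ih _ _ hu') (ih _ _ hu') (ih _ _ hu')
  have h1 : |p i t - q i t| ≤ 0 :=
    ge_of_tendsto' (FloorSemiring.tendsto_pow_div_factorial_atTop (C * t)) fun n => key n i t ht
  have := abs_nonpos_iff.1 h1
  linarith

/-- The projection onto `[0, 1]`. -/
def clip (x : ℝ) : ℝ := min (max x 0) 1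

lemma clip_mem_Icc (x : ℝ) : clip x ∈ Set.Icc (0 : ℝ) 1 :=
  ⟨le_min (le_max_right _ _) zero_le_one, min_le_right _ _⟩

lemma abs_clip_sub_clip_le (x y : ℝ) : |clip x - clip y| ≤ |x - y| := by
  have : LipschitzWith 1 clip := (LipschitzWith.id.max_const 0).min_const 1
  simpa [Real.dist_eq] using this.dist_le_mul x y

lemma clip_of_mem {x : ℝ} (h : x ∈ Set.Icc (0 : ℝ) 1) : clip x = x := by
  rw [clip, max_eq_left h.1, min_eq_left h.2]

/-- The sequence `1, clip (q 0), clip (q 1), …`. -/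
def clipSeq (q : ℕ → ℝ) : ℕ → ℝ
  | 0 => 1
  | i + 1 => clip (q i)

lemma clipSeq_mem_Icc (q : ℕ → ℝ) (i : ℕ) : clipSeq q i ∈ Set.Icc (0 : ℝ) 1 := by
  cases i with
  | zero => simp [clipSeq]
  | succ i => exact clip_mem_Icc _

lemma abs_clipSeq_sub_le (q q' : ℕ →ᵇ ℝ) (i : ℕ) : |clipSeq q i - clipSeq q' i| ≤ ‖q - q'‖ := by
  cases i with
  | zero => simp [clipSeq]
  | succ i => exact (abs_clip_sub_clip_le _ _).trans ((q - q').norm_coe_le_norm i)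

lemma abs_fluidDrift_le {lam : ℝ} (hlam : 0 ≤ lam) (d : ℕ) {a b c : ℝ}
    (ha : a ∈ Set.Icc (0 : ℝ) 1) (hb : b ∈ Set.Icc (0 : ℝ) 1) (hc : c ∈ Set.Icc (0 : ℝ) 1) :
    |fluidDrift lam d a b c| ≤ lam + 1 := by
  have h1 := pow_le_one₀ (n := d) ha.1 ha.2
  have h2 := pow_le_one₀ (n := d) hb.1 hb.2
  have h3 := pow_nonneg ha.1 d
  have h4 := pow_nonneg hb.1 d
  unfold fluidDrift
  have h5 : lam * (a ^ d - b ^ d) ≤ lam * 1 := mul_le_mul_of_nonneg_left (by linarith) hlam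
  have h6 : lam * (-1) ≤ lam * (a ^ d - b ^ d) := mul_le_mul_of_nonneg_left (by linarith) hlam
  have := hb.1
  have := hb.2
  have := hc.1
  have := hc.2
  exact abs_le.2 ⟨by linarith, by linarith⟩

/-- The vector field of the fluid equations, made bounded and Lipschitz by clipping. -/
def clippedField (lam : ℝ) (hlam : 0 ≤ lam) (d : ℕ) (q : ℕ →ᵇ ℝ) : ℕ →ᵇ ℝ :=
  BoundedContinuousFunction.ofNormedAddCommGroupDiscrete
    (fun i => fluidDrift lam d (clipSeq q i) (clipSeq q (i + 1)) (clipSeq q (i + 2))) (lam + 1)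
    fun _ => abs_fluidDrift_le hlam d (clipSeq_mem_Icc _ _) (clipSeq_mem_Icc _ _)
      (clipSeq_mem_Icc _ _)

lemma clippedField_apply {lam : ℝ} (hlam : 0 ≤ lam) (d : ℕ) (q : ℕ →ᵇ ℝ) (i : ℕ) :
    clippedField lam hlam d q i =
      fluidDrift lam d (clipSeq q i) (clipSeq q (i + 1)) (clipSeq q (i + 2)) := rfl

lemma norm_clippedField_le {lam : ℝ} (hlam : 0 ≤ lam) (d : ℕ) (q : ℕ →ᵇ ℝ) :
    ‖clippedField lam hlam d q‖ ≤ lam + 1 :=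
  (BoundedContinuousFunction.norm_le (by positivity)).2 fun _ =>
    abs_fluidDrift_le hlam d (clipSeq_mem_Icc _ _) (clipSeq_mem_Icc _ _) (clipSeq_mem_Icc _ _)

lemma norm_clippedField_sub_le {lam : ℝ} (hlam : 0 ≤ lam) (d : ℕ) (q q' : ℕ →ᵇ ℝ) :
    ‖clippedField lam hlam d q - clippedField lam hlam d q'‖ ≤
      (2 * lam * d + 2) * ‖q - q'‖ :=
  (BoundedContinuousFunction.norm_le (by positivity)).2 fun _ =>
    abs_fluidDrift_sub_le hlam d (clipSeq_mem_Icc _ _) (clipSeq_mem_Icc _ _)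
      (clipSeq_mem_Icc _ _) (clipSeq_mem_Icc _ _) (abs_clipSeq_sub_le _ _ _)
      (abs_clipSeq_sub_le _ _ _) (abs_clipSeq_sub_le _ _ _)

/-- Picard–Lindelöf in the space of bounded sequences for the clipped field. That field is bounded
by `lam + 1`, so the ball of radius `(lam + 1) * T` suffices for the whole interval. The clipping is
then seen to be inactive. Coordinate `i` of `α` is level `i + 1`, since level 0 is the constant 1.
-/
lemma exists_isFluidSolutionUpTo {lam : ℝ} (hlam : 0 ≤ lam) {d : ℕ} (hd : d ≠ 0) {T : ℝ}
    (hT : 0 ≤ T) : ∃ q, IsFluidSolutionUpTo lam d T q := by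
  have hPL : IsPicardLindelof (fun _ : ℝ => clippedField lam hlam d) (tmin := 0) (tmax := T)
      ⟨0, le_rfl, hT⟩ 0 ⟨(lam + 1) * T, by positivity⟩ 0 ⟨lam + 1, by positivity⟩
      ⟨2 * lam * d + 2, by positivity⟩ :=
    { lipschitzOnWith := fun t _ => (LipschitzWith.of_dist_le_mul fun q q' => by
        rw [dist_eq_norm, dist_eq_norm]
        exact norm_clippedField_sub_le hlam d q q').lipschitzOnWith
      continuousOn := fun _ _ => continuousOn_const
      norm_le := fun _ _ q _ => norm_clippedField_le hlam d q
      mul_max_le := by simp [hT]; rfl }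
  obtain ⟨α, hα0, hα⟩ := hPL.exists_eq_forall_mem_Icc_hasDerivWithinAt (x := 0) (by simp)
  have hα0 : α 0 = 0 := hα0
  have hder : ∀ i, ∀ t ∈ Set.Icc 0 T, HasDerivWithinAt (fun s => α s i)
      (clippedField lam hlam d (α t) i) (Set.Icc 0 T) t := fun i t ht =>
    ((BoundedContinuousFunction.evalCLM ℝ i : (ℕ →ᵇ ℝ) →L[ℝ] ℝ).hasFDerivAt
      (x := α t)).comp_hasDerivWithinAt t (hα t ht)
  have hcont : ∀ i, ContinuousOn (fun s => α s i) (Set.Icc 0 T) := fun i t ht =>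
    (hder i t ht).continuousWithinAt
  -- Where a coordinate is negative it is clipped to 0, and its drift `lam * a ^ d + c` is
  -- nonnegative; `d ≠ 0` gives `0 ^ d = 0`.
  have hnn : ∀ i, ∀ t ∈ Set.Icc 0 T, 0 ≤ α t i := by
    intro i t ht
    have := nonpos_of_deriv_nonpos_of_pos (f := fun s => -α s i)
      (f' := fun s => -clippedField lam hlam d (α s) i) (hcont i).neg
      (fun s hs => (hasDerivWithinAt_Ici_of_Icc hs (hder i s (Set.Ico_subset_Icc_self hs))).neg)
      (by simp [hα0]) (fun s hs h => by
        have h0 : clipSeq (α s) (i + 1) = 0 := by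
          have : max (α s i) 0 = 0 := max_eq_right (by linarith)
          simp [clipSeq, clip, this]
        have h1 := pow_nonneg (clipSeq_mem_Icc (α s) i).1 d
        have h2 := (clipSeq_mem_Icc (α s) (i + 2)).1
        rw [clippedField_apply, h0, fluidDrift, zero_pow hd]
        have := mul_nonneg hlam h1
        simp only [sub_zero, zero_sub]
        linarith) ht
    linarith
  -- Where a coordinate exceeds 1 it is clipped to 1, and its drift `lam * (a ^ d - 1) - (1 - c)` is
  -- nonpositive.
  have hle : ∀ i, ∀ t ∈ Set.Icc 0 T, α t i ≤ 1 := by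
    intro i t ht
    have := nonpos_of_deriv_nonpos_of_pos (f := fun s => α s i - 1)
      (f' := fun s => clippedField lam hlam d (α s) i) ((hcont i).sub continuousOn_const)
      (fun s hs => (hasDerivWithinAt_Ici_of_Icc hs
        (hder i s (Set.Ico_subset_Icc_self hs))).sub_const 1)
      (by simp [hα0]) (fun s hs h => by
        have h0 : clipSeq (α s) (i + 1) = 1 := by
          have : (1 : ℝ) ≤ max (α s i) 0 := le_max_of_le_left (by linarith)
          simp [clipSeq, clip, this]
        have h1 := pow_le_one₀ (n := d) (clipSeq_mem_Icc (α s) i).1 (clipSeq_mem_Icc (α s) i).2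
        have h2 := (clipSeq_mem_Icc (α s) (i + 2)).2
        rw [clippedField_apply, h0, fluidDrift, one_pow]
        have := mul_nonneg hlam (sub_nonneg.2 h1)
        linarith) ht
    linarith
  refine ⟨fun i t => clipSeq (α t) i, fun t _ => rfl, fun i => by simp [clipSeq, hα0, clip],
    fun i t _ => clipSeq_mem_Icc _ _, fun i t ht => ?_⟩
  refine (hder i t ht).congr (fun s hs => ?_) ?_
  · exact clip_of_mem ⟨hnn i s hs, hle i s hs⟩
  · exact clip_of_mem ⟨hnn i t ht, hle i t ht⟩

lemma exists_isFluidSolution {lam : ℝ} (hlam : 0 ≤ lam) {d : ℕ} (hd : d ≠ 0) :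
    ∃ q, IsFluidSolution lam d q := by
  choose s hs using fun n : ℕ => exists_isFluidSolutionUpTo hlam hd (T := n) n.cast_nonneg
  have hq : ∀ (n : ℕ) (i : ℕ) (t : ℝ), 0 ≤ t → t ≤ n → s ⌈t⌉₊ i t = s n i t := fun n i t h0 ht =>
    (hs ⌈t⌉₊).unique hlam ((hs n).mono (by exact_mod_cast Nat.ceil_le.2 ht)) i
      ⟨h0, Nat.le_ceil t⟩
  refine ⟨fun i t => s ⌈t⌉₊ i t, fun t ht => (hs _).zero_eq_one t ⟨ht, Nat.le_ceil t⟩,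
    fun i => (hs _).init i, fun i t ht => (hs _).mem_Icc i t ⟨ht, Nat.le_ceil t⟩,
    fun i t ht => ?_⟩
  -- Unlike `⌈t⌉₊`, this is strictly larger than `t`, so near `t` the glued function coincides with
  -- the single solution `s n`.
  set n := ⌊t⌋₊ + 1 with hn
  have htn : t < n := by exact_mod_cast Nat.lt_floor_add_one t
  have h1 := (hs n).ode i t ⟨ht, htn.le⟩
  rw [← hq n i t ht htn.le, ← hq n (i + 1) t ht htn.le, ← hq n (i + 2) t ht htn.le] at h1
  have h2 : HasDerivWithinAt (s n (i + 1)) _ (Set.Ici 0) t := h1.mono_of_mem_nhdsWithin (by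
    have : Set.Iio (n : ℝ) ∈ 𝓝 t := Iio_mem_nhds htn
    filter_upwards [self_mem_nhdsWithin, mem_nhdsWithin_of_mem_nhds this] with u hu1 hu2
    exact ⟨hu1, le_of_lt hu2⟩)
  refine h2.congr_of_eventuallyEq ?_ (hq n _ t ht htn.le)
  have : Set.Iio (n : ℝ) ∈ 𝓝 t := Iio_mem_nhds htn
  filter_upwards [self_mem_nhdsWithin, mem_nhdsWithin_of_mem_nhds this] with u hu1 hu2
  exact hq n _ u hu1 (le_of_lt hu2)

end Fluid

/-! ### Where a task goes: the assignment probabilities in closed form. -/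

section Assignment

variable {V W : Type*} [Fintype V]

lemma mem_shortestSampled {V : Type*} {d : ℕ} {x : V → ℕ} {s : Fin d → V} {v : V} :
    v ∈ shortestSampled x s ↔ (∃ k, s k = v) ∧ ∀ j, x v ≤ x (s j) := by
  simp [shortestSampled]

lemma mem_typeNbhd {E : Set (V × W)} {w : W} {v : V} : v ∈ typeNbhd E w ↔ (v, w) ∈ E := by
  simp [typeNbhd]

lemma shortestSampled_nonempty {V : Type*} {d : ℕ} (hd : d ≠ 0) (x : V → ℕ) (s : Fin d → V) :
    (shortestSampled x s).Nonempty := by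
  have : Nonempty (Fin d) := ⟨⟨0, Nat.pos_of_ne_zero hd⟩⟩
  obtain ⟨k, hk⟩ := Finite.exists_min fun k => x (s k)
  exact ⟨s k, mem_shortestSampled.2 ⟨⟨k, rfl⟩, hk⟩⟩

lemma mem_shortestSampled_comp {V : Type*} {d : ℕ} {x : V → ℕ} {s : Fin d → V} {v : V} (σ : V ≃ V)
    (hσ : ∀ u, x (σ u) = x u) : σ v ∈ shortestSampled x (σ ∘ s) ↔ v ∈ shortestSampled x s := by
  simp [mem_shortestSampled, hσ]

lemma card_shortestSampled_comp {V : Type*} {d : ℕ} {x : V → ℕ} {s : Fin d → V} (σ : V ≃ V)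
    (hσ : ∀ u, x (σ u) = x u) :
    (shortestSampled x (σ ∘ s)).card = (shortestSampled x s).card :=
  (Finset.card_bijective σ σ.bijective fun _ => (mem_shortestSampled_comp σ hσ).symm).symm

-- Exchanging two compatible servers of equal queue length is a symmetry of the uniform sampling and
-- of the tie-breaking.
open scoped Classical in
lemma assignProb_eq_of_eq {E : Set (V × W)} {d : ℕ} {x : V → ℕ} {w : W} {v v' : V}
    (hv : v ∈ typeNbhd E w) (hv' : v' ∈ typeNbhd E w) (h : x v = x v') :
    assignProb E d x w v = assignProb E d x w v' := by
  set σ := Equiv.swap v v' with hσ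
  have hx : ∀ u, x (σ u) = x u := by
    intro u
    rw [hσ, Equiv.swap_apply_def]
    split_ifs with h1 h2
    · rw [h1, h]
    · rw [h2, h]
    · rfl
  have hN : ∀ u, σ u ∈ typeNbhd E w ↔ u ∈ typeNbhd E w := by
    intro u
    rw [hσ, Equiv.swap_apply_def]
    split_ifs with h1 h2
    · simp [h1, hv, hv']
    · simp [h2, hv, hv']
    · rfl
  unfold assignProb
  refine Finset.sum_equiv (Equiv.arrowCongr (Equiv.refl _) σ) ?_ ?_
  · intro s
    simp [Fintype.mem_piFinset, hN]
  · intro s _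
    have h1 : Equiv.arrowCongr (Equiv.refl (Fin d)) σ s = σ ∘ s := by
      ext; simp
    have h2 : v' ∈ shortestSampled x (σ ∘ s) ↔ v ∈ shortestSampled x s := by
      have h3 : σ v = v' := Equiv.swap_apply_left v v'
      rw [← h3]
      exact mem_shortestSampled_comp σ hx
    rw [h1, card_shortestSampled_comp σ hx]
    simp only [h2]

lemma assignProb_eq_zero {E : Set (V × W)} {d : ℕ} {x : V → ℕ} {w : W} {v : V}
    (hv : v ∉ typeNbhd E w) : assignProb E d x w v = 0 := by
  unfold assignProb
  refine Finset.sum_eq_zero fun s hs => ?_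
  rw [if_neg, mul_zero]
  intro h
  obtain ⟨⟨k, rfl⟩, -⟩ := mem_shortestSampled.1 h
  exact hv (Fintype.mem_piFinset.1 hs k)

/-- The fraction of the servers compatible with `w` whose queue length is at least `i`. -/
noncomputable def nbhdFrac (E : Set (V × W)) (w : W) (i : ℕ) (x : V → ℕ) : ℝ :=
  ((typeNbhd E w).filter fun v => i ≤ x v).card / (typeDeg E w : ℝ)

open scoped Classical in
lemma card_level (E : Set (V × W)) (w : W) (j : ℕ) (x : V → ℕ) :
    (((typeNbhd E w).filter fun v => x v = j).card : ℝ) =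
      ((typeNbhd E w).filter fun v => j ≤ x v).card -
        ((typeNbhd E w).filter fun v => j + 1 ≤ x v).card := by
  rw [eq_sub_iff_add_eq, ← Nat.cast_add, ← Finset.card_union_of_disjoint]
  · congr 2
    ext v
    simp only [Finset.mem_union, Finset.mem_filter, ← and_or_left]
    exact and_congr_right fun _ => by omega
  · exact Finset.disjoint_filter.2 fun v _ h => by omega

lemma nbhdFrac_sub_succ (E : Set (V × W)) (w : W) (j : ℕ) (x : V → ℕ) :
    nbhdFrac E w j x - nbhdFrac E w (j + 1) x =
      ((typeNbhd E w).filter fun v => x v = j).card / (typeDeg E w : ℝ) := by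
  rw [card_level, nbhdFrac, nbhdFrac, sub_div]

-- The chosen queue has length `j` exactly when all `d` samples have length at least `j` but not all
-- have length at least `j + 1`; these are nested product events.
open scoped Classical in
lemma sum_level_assignProb {E : Set (V × W)} {d : ℕ} (hd : d ≠ 0) (x : V → ℕ) (w : W) (j : ℕ) :
    ∑ v ∈ (typeNbhd E w).filter (fun v => x v = j), assignProb E d x w v =
      nbhdFrac E w j x ^ d - nbhdFrac E w (j + 1) x ^ d := by
  set A : ℕ → Finset (Fin d → V) := fun j =>
    Fintype.piFinset fun _ : Fin d => (typeNbhd E w).filter fun v => j ≤ x v with hA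
  have hmemA : ∀ j s, s ∈ A j ↔ ∀ k, s k ∈ typeNbhd E w ∧ j ≤ x (s k) := by
    intro j s
    simp [hA, Fintype.mem_piFinset]
  have hcard : ∀ j, ((A j).card : ℝ) = ((typeNbhd E w).filter fun v => j ≤ x v).card ^ d := by
    intro j
    simp [hA]
  have hsub : A (j + 1) ⊆ A j := fun s hs => (hmemA _ _).2 fun k =>
    ⟨((hmemA _ _).1 hs k).1, by have := ((hmemA _ _).1 hs k).2; omega⟩
  -- All shortest sampled servers share one length, so for a given sample the tie-breaking
  -- probabilities at level `j` sum to 1 or to 0.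
  have hinner : ∀ s ∈ Fintype.piFinset fun _ : Fin d => typeNbhd E w,
      ∑ v ∈ (typeNbhd E w).filter (fun v => x v = j),
        (if v ∈ shortestSampled x s then 1 / ((shortestSampled x s).card : ℝ) else 0) =
      if s ∈ A j \ A (j + 1) then 1 else 0 := by
    intro s hs
    rw [Fintype.mem_piFinset] at hs
    split_ifs with h
    · rw [Finset.mem_sdiff, hmemA, hmemA] at h
      have h2 := h.2
      push Not at h2
      obtain ⟨k, hk⟩ := h2
      have hkj := hk (hs k)
      have hss : shortestSampled x s ⊆ (typeNbhd E w).filter (fun v => x v = j) := by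
        intro v hv
        obtain ⟨⟨k', rfl⟩, hmin⟩ := mem_shortestSampled.1 hv
        have h3 := hmin k
        have h4 := (h.1 k').2
        exact Finset.mem_filter.2 ⟨hs k', by omega⟩
      rw [← Finset.sum_filter, Finset.filter_mem_eq_inter, Finset.inter_eq_right.2 hss,
        Finset.sum_const, nsmul_eq_mul]
      have : ((shortestSampled x s).card : ℝ) ≠ 0 := by
        exact_mod_cast (Finset.card_pos.2 (shortestSampled_nonempty hd x s)).ne'
      field_simp
    · refine Finset.sum_eq_zero fun v hv => if_neg fun hv' => h ?_
      obtain ⟨⟨k, rfl⟩, hmin⟩ := mem_shortestSampled.1 hv'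
      have hvj := (Finset.mem_filter.1 hv).2
      rw [Finset.mem_sdiff, hmemA, hmemA]
      refine ⟨fun k' => ⟨hs k', hvj ▸ hmin k'⟩, fun h' => ?_⟩
      have := (h' k).2
      omega
  unfold assignProb
  rw [Finset.sum_comm]
  simp_rw [← Finset.mul_sum]
  rw [Finset.sum_congr rfl hinner, ← Finset.sum_filter,
    Finset.filter_mem_eq_inter, Finset.inter_eq_right.2]
  · rw [Finset.sum_const, nsmul_eq_mul, mul_one, Finset.card_sdiff_of_subset hsub,
      Nat.cast_sub (Finset.card_le_card hsub), hcard, hcard]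
    simp only [nbhdFrac, div_pow, one_pow]
    ring
  · intro s hs
    exact Fintype.mem_piFinset.2 fun k => ((hmemA _ _).1 (Finset.mem_sdiff.1 hs).1 k).1

/-- The polynomial `(a ^ d - b ^ d) / (a - b)`. -/
def geomQuot (d : ℕ) (a b : ℝ) : ℝ := ∑ k ∈ Finset.range d, a ^ k * b ^ (d - 1 - k)

lemma geomQuot_mul_sub (d : ℕ) (a b : ℝ) : geomQuot d a b * (a - b) = a ^ d - b ^ d :=
  (Commute.all a b).geom_sum₂_mul d

/-- By symmetry the probability `a ^ d - b ^ d` of hitting the level of `v` is shared equally among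
its `d_w (a - b)` servers. The polynomial form of the quotient makes the result Lipschitz in `a` and
`b`, even as `a - b` tends to 0. -/
lemma assignProb_eq {E : Set (V × W)} {d : ℕ} (hd : d ≠ 0) (x : V → ℕ) {w : W} {v : V}
    (hv : v ∈ typeNbhd E w) : assignProb E d x w v =
      1 / (typeDeg E w : ℝ) * geomQuot d (nbhdFrac E w (x v) x) (nbhdFrac E w (x v + 1) x) := by
  have h1 := sum_level_assignProb hd x w (x v) (E := E)
  rw [Finset.sum_congr rfl (g := fun _ => assignProb E d x w v) fun u hu =>
    assignProb_eq_of_eq (Finset.mem_filter.1 hu).1 hv (Finset.mem_filter.1 hu).2,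
    ← geomQuot_mul_sub, nbhdFrac_sub_succ, Finset.sum_const, nsmul_eq_mul] at h1
  have h2 : (((typeNbhd E w).filter fun u => x u = x v).card : ℝ) ≠ 0 := by
    exact_mod_cast (Finset.card_pos.2 (⟨v, by simp [hv]⟩ : Finset.Nonempty _)).ne'
  refine mul_left_cancel₀ h2 (h1.trans ?_)
  ring

lemma geomQuot_nonneg (d : ℕ) {a b : ℝ} (ha : 0 ≤ a) (hb : 0 ≤ b) : 0 ≤ geomQuot d a b :=
  Finset.sum_nonneg fun _ _ => by positivity

lemma geomQuot_le (d : ℕ) {a b : ℝ} (ha : a ∈ Set.Icc (0 : ℝ) 1) (hb : b ∈ Set.Icc (0 : ℝ) 1) :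
    geomQuot d a b ≤ d := by
  refine (Finset.sum_le_card_nsmul _ _ 1 fun k _ => ?_).trans (by simp)
  exact mul_le_one₀ (pow_le_one₀ ha.1 ha.2) (pow_nonneg hb.1 _) (pow_le_one₀ hb.1 hb.2)

lemma abs_geomQuot_sub_le (d : ℕ) {a b a' b' : ℝ} (ha : a ∈ Set.Icc (0 : ℝ) 1)
    (hb : b ∈ Set.Icc (0 : ℝ) 1) (ha' : a' ∈ Set.Icc (0 : ℝ) 1) (hb' : b' ∈ Set.Icc (0 : ℝ) 1) :
    |geomQuot d a b - geomQuot d a' b'| ≤ (d : ℝ) ^ 2 * (|a - a'| + |b - b'|) := by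
  unfold geomQuot
  rw [← Finset.sum_sub_distrib]
  refine (Finset.abs_sum_le_sum_abs _ _).trans ?_
  refine (Finset.sum_le_card_nsmul _ _ (d * (|a - a'| + |b - b'|)) fun k hk => ?_).trans
    (le_of_eq (by rw [Finset.card_range, nsmul_eq_mul]; ring))
  have hkd : (k : ℝ) ≤ d := by exact_mod_cast (Finset.mem_range.1 hk).le
  have hkd' : ((d - 1 - k : ℕ) : ℝ) ≤ d := by exact_mod_cast (by omega : d - 1 - k ≤ d)
  have h1 := (abs_pow_sub_pow_le_of_mem_Icc ha ha' k).trans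
    (mul_le_mul_of_nonneg_right hkd (abs_nonneg _))
  have h2 := (abs_pow_sub_pow_le_of_mem_Icc hb hb' (d - 1 - k)).trans
    (mul_le_mul_of_nonneg_right hkd' (abs_nonneg _))
  have h3 : a ^ k * b ^ (d - 1 - k) - a' ^ k * b' ^ (d - 1 - k) =
      (a ^ k - a' ^ k) * b ^ (d - 1 - k) + a' ^ k * (b ^ (d - 1 - k) - b' ^ (d - 1 - k)) := by ring
  rw [h3, mul_add]
  refine (abs_add_le _ _).trans (add_le_add ?_ ?_)
  · rw [abs_mul, abs_of_nonneg (pow_nonneg hb.1 _)]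
    exact (mul_le_of_le_one_right (abs_nonneg _) (pow_le_one₀ hb.1 hb.2)).trans h1
  · rw [abs_mul, abs_of_nonneg (pow_nonneg ha'.1 _)]
    exact (mul_le_of_le_one_left (abs_nonneg _) (pow_le_one₀ ha'.1 ha'.2)).trans h2

lemma nbhdFrac_mem_Icc (E : Set (V × W)) (w : W) (i : ℕ) (x : V → ℕ) :
    nbhdFrac E w i x ∈ Set.Icc (0 : ℝ) 1 := by
  refine ⟨by unfold nbhdFrac; positivity, div_le_one_of_le₀ ?_ (by positivity)⟩
  exact_mod_cast Finset.card_filter_le _ _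

end Assignment

/-! ### Arrival rates at the servers and the generator on squared deviations. -/

section Rates

variable {V W : Type*} [Fintype V] [Fintype W]

lemma mem_serverNbhd {V W : Type*} [Fintype W] {E : Set (V × W)} {w : W} {v : V} : w ∈ serverNbhd E v ↔ (v, w) ∈ E := by
  simp [serverNbhd]

lemma sum_typeNbhd_comm (E : Set (V × W)) (F : W → V → ℝ) :
    ∑ w, ∑ v ∈ typeNbhd E w, F w v = ∑ v, ∑ w ∈ serverNbhd E v, F w v :=
  Finset.sum_comm' fun w v => by simp [mem_typeNbhd, mem_serverNbhd]

/-- The rate at which tasks arrive at the server `v`. -/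
noncomputable def arrivalRate (lam : ℝ) (E : Set (V × W)) (d : ℕ) (x : V → ℕ) (v : V) : ℝ :=
  ∑ w : W, lam * (Fintype.card V : ℝ) / (Fintype.card W : ℝ) * assignProb E d x w v

/-- The sum of `g` over the task types compatible with `v`, with the weights of `serverWeight`. -/
noncomputable def weightedSum (E : Set (V × W)) (g : W → ℝ) (v : V) : ℝ :=
  (Fintype.card V : ℝ) / (Fintype.card W : ℝ) * ∑ w ∈ serverNbhd E v, 1 / (typeDeg E w : ℝ) * g w

lemma weightedSum_one (E : Set (V × W)) (v : V) : weightedSum E (fun _ => 1) v = serverWeight E v := by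
  simp [weightedSum, serverWeight]

lemma weightedSum_mono (E : Set (V × W)) {g h : W → ℝ} (hgh : ∀ w, g w ≤ h w) (v : V) :
    weightedSum E g v ≤ weightedSum E h v := by
  unfold weightedSum
  refine mul_le_mul_of_nonneg_left (Finset.sum_le_sum fun w _ => ?_) (by positivity)
  exact mul_le_mul_of_nonneg_left (hgh w) (by positivity)

lemma abs_weightedSum_le (E : Set (V × W)) (g : W → ℝ) (v : V) :
    |weightedSum E g v| ≤ weightedSum E (fun w => |g w|) v := by
  unfold weightedSum
  rw [abs_mul, abs_of_nonneg (by positivity)]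
  refine mul_le_mul_of_nonneg_left ((Finset.abs_sum_le_sum_abs _ _).trans
    (Finset.sum_le_sum fun w _ => ?_)) (by positivity)
  rw [abs_mul, abs_of_nonneg (by positivity : (0 : ℝ) ≤ 1 / (typeDeg E w : ℝ))]

lemma weightedSum_add (E : Set (V × W)) (g h : W → ℝ) (v : V) :
    weightedSum E (fun w => g w + h w) v = weightedSum E g v + weightedSum E h v := by
  simp only [weightedSum, mul_add, Finset.sum_add_distrib]

lemma weightedSum_const_mul (E : Set (V × W)) (c : ℝ) (g : W → ℝ) (v : V) :
    weightedSum E (fun w => c * g w) v = c * weightedSum E g v := by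
  simp only [weightedSum, Finset.mul_sum]
  exact Finset.sum_congr rfl fun _ _ => by ring

lemma weightedSum_const (E : Set (V × W)) (c : ℝ) (v : V) :
    weightedSum E (fun _ => c) v = c * serverWeight E v := by
  have := weightedSum_const_mul E c (fun _ => 1) v
  simpa [weightedSum_one] using this

lemma weightedSum_nonneg (E : Set (V × W)) {g : W → ℝ} (hg : ∀ w, 0 ≤ g w) (v : V) :
    0 ≤ weightedSum E g v := by
  have := weightedSum_mono E (g := fun _ => 0) hg v
  simpa [weightedSum_const] using this

lemma arrivalRate_eq {lam : ℝ} {E : Set (V × W)} {d : ℕ} (hd : d ≠ 0) (x : V → ℕ) (v : V) :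
    arrivalRate lam E d x v = lam * weightedSum E
      (fun w => geomQuot d (nbhdFrac E w (x v) x) (nbhdFrac E w (x v + 1) x)) v := by
  unfold arrivalRate weightedSum
  rw [← Finset.sum_subset (Finset.subset_univ (serverNbhd E v)) fun w _ hw => by
    rw [assignProb_eq_zero (fun h => hw (mem_serverNbhd.2 (mem_typeNbhd.1 h))), mul_zero],
    Finset.mul_sum, Finset.mul_sum]
  refine Finset.sum_congr rfl fun w hw => ?_
  rw [assignProb_eq hd x (mem_typeNbhd.2 (mem_serverNbhd.1 hw))]
  ring

lemma arrivalRate_nonneg {lam : ℝ} (hlam : 0 ≤ lam) (E : Set (V × W)) (d : ℕ) (x : V → ℕ)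
    (v : V) : 0 ≤ arrivalRate lam E d x v :=
  Finset.sum_nonneg fun w _ => mul_nonneg (by positivity) (assignProb_nonneg E d x w v)

lemma arrivalRate_le {lam : ℝ} (hlam : 0 ≤ lam) {E : Set (V × W)} {d : ℕ} (hd : d ≠ 0)
    (x : V → ℕ) (v : V) : arrivalRate lam E d x v ≤ lam * (d * serverWeight E v) := by
  rw [arrivalRate_eq hd, ← weightedSum_const]
  exact mul_le_mul_of_nonneg_left (weightedSum_mono E (fun w =>
    geomQuot_le d (nbhdFrac_mem_Icc _ _ _ _) (nbhdFrac_mem_Icc _ _ _ _)) v) hlam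

open Classical in
lemma generatorFun_eq (lam : ℝ) (E : Set (V × W)) (d : ℕ) (f : (V → ℕ) → ℝ) (x : V → ℕ) :
    generatorFun lam E d f x =
      ∑ v, (arrivalRate lam E d x v * (f (Function.update x v (x v + 1)) - f x) +
        if 0 < x v then f (Function.update x v (x v - 1)) - f x else 0) := by
  unfold generatorFun arrivalRate
  rw [Finset.sum_comm, ← Finset.sum_add_distrib]
  simp only [Finset.sum_mul]

lemma generatorFun_sum {ι : Type*} (s : Finset ι) (lam : ℝ) (E : Set (V × W)) (d : ℕ)
    (a : ι → ℝ) (f : ι → (V → ℕ) → ℝ) (x : V → ℕ) :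
    generatorFun lam E d (fun y => ∑ j ∈ s, a j * f j y) x =
      ∑ j ∈ s, a j * generatorFun lam E d (f j) x := by
  classical
  simp only [generatorFun_eq, Finset.mul_sum]
  rw [Finset.sum_comm]
  refine Finset.sum_congr rfl fun v _ => ?_
  rw [← Finset.sum_sub_distrib, ← Finset.sum_sub_distrib, Finset.mul_sum]
  split_ifs
  · rw [← Finset.sum_add_distrib]
    exact Finset.sum_congr rfl fun j _ => by ring
  · rw [add_zero]
    exact Finset.sum_congr rfl fun j _ => by ring

lemma nbhdFrac_eq_sum {V W : Type*} [Fintype V] (E : Set (V × W)) (w : W) (i : ℕ) (x : V → ℕ) :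
    nbhdFrac E w i x = 1 / (typeDeg E w : ℝ) * ∑ v ∈ typeNbhd E w, if i ≤ x v then (1 : ℝ) else 0 := by
  rw [nbhdFrac, Finset.card_filter]
  push_cast
  ring

open Classical in
lemma nbhdFrac_update_sub {V W : Type*} [Fintype V] (E : Set (V × W)) (w : W) (i : ℕ) (x : V → ℕ) (v : V) (n : ℕ) :
    nbhdFrac E w i (Function.update x v n) - nbhdFrac E w i x =
      if v ∈ typeNbhd E w then
        1 / (typeDeg E w : ℝ) * ((if i ≤ n then 1 else 0) - if i ≤ x v then 1 else 0)
      else 0 := by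
  rw [nbhdFrac_eq_sum, nbhdFrac_eq_sum, ← mul_sub, ← Finset.sum_sub_distrib]
  have h : ∀ u ∈ typeNbhd E w, u ≠ v →
      ((if i ≤ Function.update x v n u then (1 : ℝ) else 0) - if i ≤ x u then 1 else 0) = 0 := by
    intro u _ hu
    rw [Function.update_of_ne hu, sub_self]
  by_cases hv : v ∈ typeNbhd E w
  · rw [Finset.sum_eq_single_of_mem v hv h, if_pos hv, Function.update_self]
  · rw [if_neg hv, Finset.sum_eq_zero fun u hu => h u hu fun he => hv (he ▸ hu), mul_zero]

/-- The action of the generator on `(q_{i+1}^w - c)²`. -/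
lemma generatorFun_sq_nbhdFrac (lam : ℝ) (E : Set (V × W)) (d : ℕ) (w : W) (i : ℕ) (c : ℝ)
    (x : V → ℕ) :
    generatorFun lam E d (fun y => (nbhdFrac E w (i + 1) y - c) ^ 2) x =
      2 * (nbhdFrac E w (i + 1) x - c) *
        (1 / (typeDeg E w : ℝ) * (∑ v ∈ (typeNbhd E w).filter (fun v => x v = i),
          arrivalRate lam E d x v) - (nbhdFrac E w (i + 1) x - nbhdFrac E w (i + 2) x)) +
      (1 / (typeDeg E w : ℝ)) ^ 2 * ∑ v ∈ typeNbhd E w,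
        ((if x v = i then arrivalRate lam E d x v else 0) + if x v = i + 1 then 1 else 0) := by
  classical
  set D := nbhdFrac E w (i + 1) x - c with hD
  set δ : ℝ := 1 / (typeDeg E w : ℝ) with hδ
  -- Only an arrival at a compatible server of length `i` or a departure from one of length `i + 1`
  -- changes the fraction, by `+δ` or `-δ`. The square then changes by `±2 D δ + δ ^ 2`.
  have hterm : ∀ v, (arrivalRate lam E d x v * ((nbhdFrac E w (i + 1)
        (Function.update x v (x v + 1)) - c) ^ 2 - (nbhdFrac E w (i + 1) x - c) ^ 2) +
        if 0 < x v then ((nbhdFrac E w (i + 1) (Function.update x v (x v - 1)) - c) ^ 2 -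
          (nbhdFrac E w (i + 1) x - c) ^ 2) else 0) =
      if v ∈ typeNbhd E w then
        (2 * D * δ * ((if x v = i then arrivalRate lam E d x v else 0) -
          if x v = i + 1 then 1 else 0) +
        δ ^ 2 * ((if x v = i then arrivalRate lam E d x v else 0) +
          if x v = i + 1 then 1 else 0)) else 0 := by
    intro v
    have hsq : ∀ y, (nbhdFrac E w (i + 1) y - c) ^ 2 - (nbhdFrac E w (i + 1) x - c) ^ 2 =
        (nbhdFrac E w (i + 1) y - nbhdFrac E w (i + 1) x) *
          (2 * D + (nbhdFrac E w (i + 1) y - nbhdFrac E w (i + 1) x)) := by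
      intro y; rw [hD]; ring
    rw [hsq, hsq, nbhdFrac_update_sub, nbhdFrac_update_sub]
    by_cases hv : v ∈ typeNbhd E w
    · simp only [if_pos hv, ← hδ]
      rcases lt_trichotomy (x v) i with h | h | h
      · rw [if_neg (by omega : ¬ i + 1 ≤ x v + 1), if_neg (by omega : ¬ i + 1 ≤ x v),
          if_neg (by omega : ¬ i + 1 ≤ x v - 1), if_neg (by omega : ¬ x v = i),
          if_neg (by omega : ¬ x v = i + 1)]
        simp
      · rw [if_pos (by omega : i + 1 ≤ x v + 1), if_neg (by omega : ¬ i + 1 ≤ x v),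
          if_neg (by omega : ¬ i + 1 ≤ x v - 1), if_pos h,
          if_neg (by omega : ¬ x v = i + 1)]
        simp
        ring
      · rw [if_pos (by omega : i + 1 ≤ x v + 1), if_pos (by omega : i + 1 ≤ x v),
          if_neg (by omega : ¬ x v = i), if_pos (by omega : 0 < x v)]
        by_cases h' : x v = i + 1
        · rw [if_pos h', if_neg (by omega : ¬ i + 1 ≤ x v - 1)]
          ring
        · rw [if_neg h', if_pos (by omega : i + 1 ≤ x v - 1)]
          ring
    · simp [hv]
  rw [generatorFun_eq, Finset.sum_congr rfl fun v _ => hterm v, ← Finset.sum_filter,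
    Finset.filter_mem_eq_inter, Finset.univ_inter, Finset.sum_add_distrib, ← Finset.mul_sum,
    ← Finset.mul_sum, Finset.sum_sub_distrib, nbhdFrac_sub_succ, Finset.sum_filter]
  simp only [Finset.card_filter, Nat.cast_sum, Nat.cast_ite, Nat.cast_one, Nat.cast_zero]
  ring

end Rates

/-! ### One-level drift estimates and the two-step averaging bound. -/

section Drift

variable {V W : Type*} [Fintype V] [Fintype W]

/-- The two sources of error are separated: the fractions seen by the types around `v` differ from
`c₀`, `c₁`, and the total weight of `v` differs from 1. -/
lemma abs_arrivalRate_sub_le {lam : ℝ} (hlam : 0 ≤ lam) {E : Set (V × W)} {d : ℕ} (hd : d ≠ 0)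
    {φ c₀ c₁ : ℝ} (hc₀ : c₀ ∈ Set.Icc (0 : ℝ) 1) (hc₁ : c₁ ∈ Set.Icc (0 : ℝ) 1) (x : V → ℕ) (v : V)
    (hφ : |serverWeight E v - 1| ≤ φ) :
    |arrivalRate lam E d x v - lam * geomQuot d c₀ c₁| ≤
      lam * ((d : ℝ) ^ 2 * weightedSum E (fun w => |nbhdFrac E w (x v) x - c₀| +
        |nbhdFrac E w (x v + 1) x - c₁|) v + d * φ) := by
  set g : W → ℝ := fun w => geomQuot d (nbhdFrac E w (x v) x) (nbhdFrac E w (x v + 1) x) -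
    geomQuot d c₀ c₁ with hg
  have h1 : arrivalRate lam E d x v - lam * geomQuot d c₀ c₁ =
      lam * (weightedSum E g v + geomQuot d c₀ c₁ * (serverWeight E v - 1)) := by
    have h2 := weightedSum_add E g (fun _ => geomQuot d c₀ c₁) v
    simp only [hg, sub_add_cancel, weightedSum_const] at h2
    rw [arrivalRate_eq hd, h2]
    ring
  rw [h1, abs_mul, abs_of_nonneg hlam]
  refine mul_le_mul_of_nonneg_left ((abs_add_le _ _).trans (add_le_add ?_ ?_)) hlam
  · rw [← weightedSum_const_mul]
    exact (abs_weightedSum_le _ _ _).trans (weightedSum_mono E (fun w =>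
      abs_geomQuot_sub_le d (nbhdFrac_mem_Icc _ _ _ _) (nbhdFrac_mem_Icc _ _ _ _) hc₀ hc₁) v)
  · rw [abs_mul, abs_of_nonneg (geomQuot_nonneg d hc₀.1 hc₁.1)]
    exact mul_le_mul (geomQuot_le d hc₀ hc₁) hφ (abs_nonneg _) d.cast_nonneg

lemma abs_nbhdFrac_sub_le_one {V W : Type*} [Fintype V] (E : Set (V × W)) (w : W) (i : ℕ)
    (x : V → ℕ) {c : ℝ} (hc : c ∈ Set.Icc (0 : ℝ) 1) : |nbhdFrac E w i x - c| ≤ 1 := by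
  have := nbhdFrac_mem_Icc E w i x
  exact abs_le.2 ⟨by linarith [this.1, hc.2], by linarith [this.2, hc.1]⟩

lemma average_typeNbhd_le {V W : Type*} [Fintype V] {E : Set (V × W)} {w : W}
    (hw : 1 ≤ typeDeg E w) {g : V → ℝ} {C : ℝ} (hg : ∀ v, g v ≤ C) :
    1 / (typeDeg E w : ℝ) * ∑ v ∈ typeNbhd E w, g v ≤ C := by
  have h1 : (0 : ℝ) < typeDeg E w := by exact_mod_cast hw
  rw [one_div, inv_mul_le_iff₀ h1]
  refine (Finset.sum_le_card_nsmul _ _ C fun v _ => hg v).trans (le_of_eq ?_)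
  rw [nsmul_eq_mul, typeDeg]

set_option maxHeartbeats 2000000 in
/-- The contribution of one task type to the drift of the squared deviations. -/
lemma generatorFun_sq_nbhdFrac_le {lam : ℝ} (hlam : 0 ≤ lam) {E : Set (V × W)} {d : ℕ}
    (hd : d ≠ 0) {φ ρ : ℝ} (hρ : ∀ v, serverWeight E v ≤ ρ) (hφ : ∀ v, |serverWeight E v - 1| ≤ φ)
    {c₀ c₁ c₂ : ℝ} (hc₀ : c₀ ∈ Set.Icc (0 : ℝ) 1) (hc₁ : c₁ ∈ Set.Icc (0 : ℝ) 1)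
    (x : V → ℕ) (i : ℕ) {w : W} (hw : 1 ≤ typeDeg E w) :
    generatorFun lam E d (fun y => (nbhdFrac E w (i + 1) y - c₁) ^ 2) x -
      2 * fluidDrift lam d c₀ c₁ c₂ * (nbhdFrac E w (i + 1) x - c₁) ≤
    lam * d ^ 2 * (2 * ρ * (nbhdFrac E w (i + 1) x - c₁) ^ 2 + 1 / (typeDeg E w : ℝ) *
        ∑ v ∈ typeNbhd E w, weightedSum E (fun w => (nbhdFrac E w i x - c₀) ^ 2 +
          (nbhdFrac E w (i + 1) x - c₁) ^ 2) v) + 2 * lam * d * φ +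
      lam * d * ((nbhdFrac E w i x - c₀) ^ 2 + (nbhdFrac E w (i + 1) x - c₁) ^ 2) +
      (nbhdFrac E w (i + 2) x - c₂) ^ 2 + (lam * d * ρ + 1) * (1 / (typeDeg E w : ℝ)) := by
  set q₀ := nbhdFrac E w i x with hq₀
  set q₁ := nbhdFrac E w (i + 1) x with hq₁
  set q₂ := nbhdFrac E w (i + 2) x with hq₂
  set Q := geomQuot d c₀ c₁ with hQ
  set δ : ℝ := 1 / (typeDeg E w : ℝ) with hδ
  have hδ0 : 0 ≤ δ := by positivity
  have hQ0 : 0 ≤ Q := geomQuot_nonneg d hc₀.1 hc₁.1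
  have hQd : Q ≤ d := geomQuot_le d hc₀ hc₁
  set g : W → ℝ := fun w => (nbhdFrac E w i x - c₀) ^ 2 + (nbhdFrac E w (i + 1) x - c₁) ^ 2 with hg
  set L := (typeNbhd E w).filter (fun v => x v = i) with hL
  have hq : q₀ - q₁ = L.card * δ := by rw [hq₀, hq₁, nbhdFrac_sub_succ, hδ]; ring
  -- Each arrival rate is replaced by the fluid rate `lam * Q`, with `Q` evaluated at the fluid
  -- values. The main term becomes linear in the fractions, and subtracting the fluid drift leaves
  -- only deviations, treated in `hC`, `hB` and `hD`.
  have hsplit : δ * ∑ v ∈ L, arrivalRate lam E d x v =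
      δ * ∑ v ∈ L, (arrivalRate lam E d x v - lam * Q) + lam * Q * (q₀ - q₁) := by
    rw [Finset.sum_sub_distrib, Finset.sum_const, nsmul_eq_mul, hq]
    ring
  have hC : 2 * (q₁ - c₁) * (δ * ∑ v ∈ L, (arrivalRate lam E d x v - lam * Q)) ≤
      lam * d ^ 2 * (2 * ρ * (q₁ - c₁) ^ 2 + δ * ∑ v ∈ typeNbhd E w, weightedSum E g v) +
        2 * lam * d * φ := by
    -- Young's inequality is used inside the weighted sum, so that squared deviations of the
    -- neighbouring types appear. The nonnegative bound allows the sum over `L` to be enlarged to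
    -- the whole neighbourhood.
    have hpt : ∀ v ∈ L, 2 * (q₁ - c₁) * (arrivalRate lam E d x v - lam * Q) ≤
        lam * d ^ 2 * (2 * ρ * (q₁ - c₁) ^ 2 + weightedSum E g v) + 2 * lam * d * φ := by
      intro v hv
      have hvi : x v = i := (Finset.mem_filter.1 hv).2
      have h1 := abs_arrivalRate_sub_le hlam hd hc₀ hc₁ x v (hφ v)
      rw [hvi] at h1
      have h2 : 2 * (q₁ - c₁) * (arrivalRate lam E d x v - lam * Q) ≤
          2 * |q₁ - c₁| * |arrivalRate lam E d x v - lam * Q| := by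
        refine (le_abs_self _).trans (le_of_eq ?_)
        rw [abs_mul, abs_mul, abs_two]
      have h3 := mul_le_mul_of_nonneg_left h1 (by positivity : 0 ≤ 2 * |q₁ - c₁|)
      have h4 : 2 * |q₁ - c₁| * weightedSum E (fun w => |nbhdFrac E w i x - c₀| +
          |nbhdFrac E w (i + 1) x - c₁|) v ≤ 2 * ρ * (q₁ - c₁) ^ 2 + weightedSum E g v := by
        rw [← weightedSum_const_mul]
        calc _ ≤ weightedSum E (fun w' => 2 * (q₁ - c₁) ^ 2 + g w') v := by
              refine weightedSum_mono E (fun w' => ?_) v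
              have e1 := two_mul_le_add_sq |q₁ - c₁| |nbhdFrac E w' i x - c₀|
              have e2 := two_mul_le_add_sq |q₁ - c₁| |nbhdFrac E w' (i + 1) x - c₁|
              simp only [sq_abs] at e1 e2
              simp only [hg]
              linarith
          _ = 2 * (q₁ - c₁) ^ 2 * serverWeight E v + weightedSum E g v := by
              rw [weightedSum_add, weightedSum_const]
          _ ≤ _ := by
              have := mul_le_mul_of_nonneg_left (hρ v) (by positivity : 0 ≤ 2 * (q₁ - c₁) ^ 2)
              linarith
      have h5 : |q₁ - c₁| ≤ 1 := abs_nbhdFrac_sub_le_one E w (i + 1) x hc₁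
      have hφ0 : 0 ≤ φ := (abs_nonneg _).trans (hφ v)
      have h6 := mul_le_mul_of_nonneg_left h4 (by positivity : 0 ≤ lam * (d : ℝ) ^ 2)
      have h7 := mul_le_mul_of_nonneg_left h5 (by positivity : 0 ≤ 2 * lam * (d : ℝ) * φ)
      linarith
    have hsum : ∑ v ∈ L, 2 * (q₁ - c₁) * (arrivalRate lam E d x v - lam * Q) ≤
        ∑ v ∈ typeNbhd E w,
          (lam * d ^ 2 * (2 * ρ * (q₁ - c₁) ^ 2 + weightedSum E g v) + 2 * lam * d * φ) := by
      refine (Finset.sum_le_sum hpt).trans (Finset.sum_le_sum_of_subset_of_nonneg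
        (Finset.filter_subset _ _) fun v _ _ => ?_)
      have h1 : 0 ≤ weightedSum E g v := 
        weightedSum_nonneg E (fun w => add_nonneg (sq_nonneg _) (sq_nonneg _)) v
      have h2 : 0 ≤ ρ := le_trans (by unfold serverWeight; positivity) (hρ v)
      have hφ0 : 0 ≤ φ := (abs_nonneg _).trans (hφ v)
      positivity
    have h1 := mul_le_mul_of_nonneg_left hsum hδ0
    rw [← Finset.mul_sum, Finset.sum_add_distrib, ← Finset.mul_sum, Finset.sum_add_distrib,
      Finset.sum_const, Finset.sum_const, nsmul_eq_mul, nsmul_eq_mul] at h1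
    have h2 : δ * (typeNbhd E w).card = 1 := by
      have : (typeDeg E w : ℝ) ≠ 0 := by exact_mod_cast (by omega : typeDeg E w ≠ 0)
      rw [hδ, one_div]
      exact inv_mul_cancel₀ this
    calc _ = δ * (2 * (q₁ - c₁) * ∑ v ∈ L, (arrivalRate lam E d x v - lam * Q)) := by ring
      _ ≤ _ := h1
      _ = lam * d ^ 2 * ((δ * (typeNbhd E w).card) * (2 * ρ * (q₁ - c₁) ^ 2) +
            δ * ∑ v ∈ typeNbhd E w, weightedSum E g v) +
            (δ * (typeNbhd E w).card) * (2 * lam * d * φ) := by ring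
      _ = _ := by rw [h2]; ring
  -- The noise term: about `d_w` servers, each jumping by `1 / d_w` at bounded rate, contribute `O(1
  -- / d_w)`, whose mean over the types is `γ`.
  have hjump : δ ^ 2 * ∑ v ∈ typeNbhd E w,
      ((if x v = i then arrivalRate lam E d x v else 0) + if x v = i + 1 then 1 else 0) ≤
      (lam * d * ρ + 1) * δ := by
    have h1 := average_typeNbhd_le hw (C := lam * d * ρ + 1) (g := fun v =>
      (if x v = i then arrivalRate lam E d x v else 0) + if x v = i + 1 then 1 else 0) fun v => by
        have e1 := arrivalRate_le hlam (E := E) hd x v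
        have e2 := mul_le_mul_of_nonneg_left (hρ v) (by positivity : 0 ≤ lam * (d : ℝ))
        have e3 := arrivalRate_nonneg hlam E d x v
        split_ifs <;> linarith
    have h2 := mul_le_mul_of_nonneg_left h1 hδ0
    rw [← hδ] at h2
    linarith
  have hB : 2 * (q₁ - c₁) * (lam * Q * ((q₀ - c₀) - (q₁ - c₁))) ≤
      lam * d * ((q₀ - c₀) ^ 2 + (q₁ - c₁) ^ 2) := by
    have e1 : 2 * (q₁ - c₁) * ((q₀ - c₀) - (q₁ - c₁)) ≤ (q₀ - c₀) ^ 2 + (q₁ - c₁) ^ 2 := by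
      nlinarith [sq_nonneg ((q₀ - c₀) - (q₁ - c₁)), sq_nonneg (q₁ - c₁)]
    have e2 := mul_le_mul_of_nonneg_left e1 (mul_nonneg hlam hQ0)
    have e3 := mul_le_mul_of_nonneg_right (mul_le_mul_of_nonneg_left hQd hlam)
      (by positivity : 0 ≤ (q₀ - c₀) ^ 2 + (q₁ - c₁) ^ 2)
    linarith
  have hD : -(2 * (q₁ - c₁) * ((q₁ - c₁) - (q₂ - c₂))) ≤ (q₂ - c₂) ^ 2 := by
    nlinarith [sq_nonneg ((q₁ - c₁) - (q₂ - c₂)), sq_nonneg (q₁ - c₁)]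
  have hdrift : fluidDrift lam d c₀ c₁ c₂ = lam * (Q * (c₀ - c₁)) - (c₁ - c₂) := by
    rw [hQ, geomQuot_mul_sub, fluidDrift]
  rw [generatorFun_sq_nbhdFrac, ← hδ, ← hL, hsplit, hdrift]
  linarith

/-- The operator type → server → type has a symmetric kernel, so the sums may be exchanged. The
total mass received from a type `w` is then `g w` times the average of `serverWeight` over its
servers, which is at most `ρ`. This closes the Lyapunov estimate. -/
lemma sum_weightedSum_le {E : Set (V × W)} (hdeg : ∀ w, 1 ≤ typeDeg E w) {ρ : ℝ}
    (hρ : ∀ v, serverWeight E v ≤ ρ) {g : W → ℝ} (hg : ∀ w, 0 ≤ g w) :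
    ∑ w, 1 / (typeDeg E w : ℝ) * ∑ v ∈ typeNbhd E w, weightedSum E g v ≤ ρ * ∑ w, g w := by
  have h1 : ∑ w, 1 / (typeDeg E w : ℝ) * ∑ v ∈ typeNbhd E w, weightedSum E g v =
      ∑ w, g w * (1 / (typeDeg E w : ℝ) * ∑ v ∈ typeNbhd E w, serverWeight E v) := by
    simp only [Finset.mul_sum]
    rw [sum_typeNbhd_comm E fun w v => 1 / (typeDeg E w : ℝ) * weightedSum E g v,
      sum_typeNbhd_comm E fun w v => g w * (1 / (typeDeg E w : ℝ) * serverWeight E v)]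
    refine Finset.sum_congr rfl fun v _ => ?_
    have e1 : ∑ w ∈ serverNbhd E v, g w * (1 / (typeDeg E w : ℝ) * serverWeight E v) =
        (∑ w ∈ serverNbhd E v, 1 / (typeDeg E w : ℝ) * g w) * serverWeight E v := by
      rw [Finset.sum_mul]
      exact Finset.sum_congr rfl fun _ _ => by ring
    rw [← Finset.sum_mul, e1, weightedSum, serverWeight]
    ring
  rw [h1, Finset.mul_sum]
  refine Finset.sum_le_sum fun w _ => ?_
  rw [mul_comm ρ]
  exact mul_le_mul_of_nonneg_left (average_typeNbhd_le (hdeg w) hρ) (hg w)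

/-- The mean over the task types of the squared deviations of the fractions from `c`. -/
noncomputable def meanSqDev (E : Set (V × W)) (i : ℕ) (c : ℝ) (x : V → ℕ) : ℝ :=
  ∑ w, 1 / (Fintype.card W : ℝ) * (nbhdFrac E w i x - c) ^ 2

lemma meanSqDev_nonneg (E : Set (V × W)) (i : ℕ) (c : ℝ) (x : V → ℕ) : 0 ≤ meanSqDev E i c x :=
  Finset.sum_nonneg fun _ _ => by positivity

lemma meanSqDev_le_one (E : Set (V × W)) (i : ℕ) {c : ℝ} (hc : c ∈ Set.Icc (0 : ℝ) 1)
    (x : V → ℕ) : meanSqDev E i c x ≤ 1 := by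
  unfold meanSqDev
  rw [← Finset.mul_sum]
  have h1 : ∑ w, (nbhdFrac E w i x - c) ^ 2 ≤ Fintype.card W := by
    refine (Finset.sum_le_card_nsmul _ _ 1 fun w _ => ?_).trans (by simp)
    exact (sq_le_one_iff_abs_le_one _).2 (abs_nbhdFrac_sub_le_one E w i x hc)
  rw [one_div, inv_mul_eq_div]
  exact div_le_one_of_le₀ h1 (by positivity)

/-- The subtracted term is what the motion of the fluid value `c₁` contributes when time is
differentiated. The estimate at one level involves both adjacent levels, with one common crude
constant. -/
lemma generatorFun_meanSqDev_le {lam : ℝ} (hlam : 0 ≤ lam) {E : Set (V × W)} [Nonempty W] {d : ℕ}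
    (hd : d ≠ 0) (hdeg : ∀ w, 1 ≤ typeDeg E w) {φ ρ : ℝ} (hρ : ∀ v, serverWeight E v ≤ ρ)
    (hφ : ∀ v, |serverWeight E v - 1| ≤ φ) {c₀ c₁ c₂ : ℝ} (hc₀ : c₀ ∈ Set.Icc (0 : ℝ) 1)
    (hc₁ : c₁ ∈ Set.Icc (0 : ℝ) 1) (x : V → ℕ) (i : ℕ) :
    generatorFun lam E d (meanSqDev E (i + 1) c₁) x -
      2 * fluidDrift lam d c₀ c₁ c₂ *
        ∑ w, 1 / (Fintype.card W : ℝ) * (nbhdFrac E w (i + 1) x - c₁) ≤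
    (3 * lam * d ^ 2 * ρ + lam * d + 1) * (meanSqDev E i c₀ x + meanSqDev E (i + 1) c₁ x +
      meanSqDev E (i + 2) c₂ x) + (2 * lam * d * φ + (lam * d * ρ + 1) * graphGamma E) := by
  set m : ℝ := 1 / (Fintype.card W : ℝ) with hm
  have hm0 : 0 ≤ m := by positivity
  have hmW : m * Fintype.card W = 1 := by
    have : (Fintype.card W : ℝ) ≠ 0 := by exact_mod_cast Fintype.card_ne_zero
    rw [hm]; field_simp
  have hρ0 : 0 ≤ ρ := by
    obtain ⟨w⟩ := ‹Nonempty W›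
    obtain ⟨v, -⟩ := Finset.card_pos.1 (show 0 < (typeNbhd E w).card from hdeg w)
    exact le_trans (by unfold serverWeight; positivity) (hρ v)
  have hgen : generatorFun lam E d (meanSqDev E (i + 1) c₁) x =
      ∑ w, m * generatorFun lam E d (fun y => (nbhdFrac E w (i + 1) y - c₁) ^ 2) x :=
    generatorFun_sum Finset.univ lam E d (fun _ => m) _ x
  have hpt := Finset.sum_le_sum fun w (_ : w ∈ Finset.univ) => mul_le_mul_of_nonneg_left
    (generatorFun_sq_nbhdFrac_le hlam hd hρ hφ hc₀ hc₁ (c₂ := c₂) x i (hdeg w)) hm0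
  have hex := mul_le_mul_of_nonneg_left (sum_weightedSum_le hdeg hρ (g := fun w =>
    (nbhdFrac E w i x - c₀) ^ 2 + (nbhdFrac E w (i + 1) x - c₁) ^ 2) fun w => by positivity) hm0
  set G : W → ℝ := fun w => 1 / (typeDeg E w : ℝ) *
        ∑ v ∈ typeNbhd E w, weightedSum E (fun w => (nbhdFrac E w i x - c₀) ^ 2 +
          (nbhdFrac E w (i + 1) x - c₁) ^ 2) v with hG
  have hex' : m * ∑ w, G w ≤ ρ * (meanSqDev E i c₀ x + meanSqDev E (i + 1) c₁ x) := by
    refine hex.trans (le_of_eq ?_)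
    simp only [meanSqDev, ← hm, ← Finset.mul_sum, Finset.sum_add_distrib]
    ring
  have hγ : graphGamma E = m * ∑ w, 1 / (typeDeg E w : ℝ) := rfl
  have hL : generatorFun lam E d (meanSqDev E (i + 1) c₁) x -
      2 * fluidDrift lam d c₀ c₁ c₂ * ∑ w, m * (nbhdFrac E w (i + 1) x - c₁) =
      ∑ w, m * (generatorFun lam E d (fun y => (nbhdFrac E w (i + 1) y - c₁) ^ 2) x -
        2 * fluidDrift lam d c₀ c₁ c₂ * (nbhdFrac E w (i + 1) x - c₁)) := by
    rw [hgen, Finset.mul_sum, ← Finset.sum_sub_distrib]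
    exact Finset.sum_congr rfl fun _ _ => by ring
  have hR : ∑ w, m * (lam * d ^ 2 * (2 * ρ * (nbhdFrac E w (i + 1) x - c₁) ^ 2 + G w) +
      2 * lam * d * φ +
      lam * d * ((nbhdFrac E w i x - c₀) ^ 2 + (nbhdFrac E w (i + 1) x - c₁) ^ 2) +
      (nbhdFrac E w (i + 2) x - c₂) ^ 2 + (lam * d * ρ + 1) * (1 / (typeDeg E w : ℝ))) =
      lam * d ^ 2 * (2 * ρ * meanSqDev E (i + 1) c₁ x + m * ∑ w, G w) + 2 * lam * d * φ +
      lam * d * (meanSqDev E i c₀ x + meanSqDev E (i + 1) c₁ x) + meanSqDev E (i + 2) c₂ x +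
      (lam * d * ρ + 1) * graphGamma E := by
    rw [hγ]
    simp only [meanSqDev, ← hm, ← Finset.mul_sum, Finset.sum_add_distrib, Finset.sum_const,
      Finset.card_univ, nsmul_eq_mul]
    linear_combination (2 * lam * d * φ) * hmW
  rw [hL]
  refine (hpt.trans (le_of_eq hR)).trans ?_
  have e0 := meanSqDev_nonneg E i c₀ x
  have e1 := meanSqDev_nonneg E (i + 1) c₁ x
  have e2 := meanSqDev_nonneg E (i + 2) c₂ x
  have h1 := mul_le_mul_of_nonneg_left hex' (by positivity : 0 ≤ lam * (d : ℝ) ^ 2)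
  have h2 : 0 ≤ 2 * (lam * d ^ 2 * ρ) * meanSqDev E i c₀ x := by positivity
  have h3 : 0 ≤ (3 * (lam * d ^ 2 * ρ) + lam * d) * meanSqDev E (i + 2) c₂ x := by positivity
  linarith

end Drift

/-! ### The Lyapunov function and its Gronwall inequality. -/

section Lyapunov

/-- Shifting the index by one changes a geometric weight by a factor 2, so adjacent levels cost `1/2
+ 1 + 2 ≤ 4`. Only the level `L + 1` above the truncation escapes, with weight `2^{-L}`. -/
lemma sum_geometric_mul_le {S : ℕ → ℝ} (h0 : S 0 = 0) (hS : ∀ i, 0 ≤ S i) (L : ℕ) :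
    ∑ i ∈ Finset.range L, (1 / 2 : ℝ) ^ (i + 1) * (S i + S (i + 1) + S (i + 2)) ≤
      4 * ∑ i ∈ Finset.range L, (1 / 2 : ℝ) ^ (i + 1) * S (i + 1) + (1 / 2) ^ L * S (L + 1) := by
  -- The added term reserves room for the contribution of `S L` that enters at the next step of the
  -- induction.
  have key : ∑ i ∈ Finset.range L, (1 / 2 : ℝ) ^ (i + 1) * (S i + S (i + 1) + S (i + 2)) +
      (1 / 2) ^ (L + 1) * S L ≤
      4 * ∑ i ∈ Finset.range L, (1 / 2 : ℝ) ^ (i + 1) * S (i + 1) + (1 / 2) ^ L * S (L + 1) := by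
    induction L with
    | zero => simp [h0, hS 1]
    | succ L ih =>
      rw [Finset.sum_range_succ, Finset.sum_range_succ]
      have h1 : 0 ≤ (1 / 2 : ℝ) ^ L * S (L + 1) := mul_nonneg (by positivity) (hS _)
      have e1 : (1 / 2 : ℝ) ^ (L + 1) = 1 / 2 * (1 / 2) ^ L := pow_succ' _ _
      have e2 : (1 / 2 : ℝ) ^ (L + 1 + 1) = 1 / 4 * (1 / 2) ^ L := by rw [pow_succ, pow_succ]; ring
      rw [e1] at ih
      rw [e2, e1]
      linarith
  have : 0 ≤ (1 / 2 : ℝ) ^ (L + 1) * S L := mul_nonneg (by positivity) (hS _)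
  linarith

lemma sum_half_pow_le_one (L : ℕ) : ∑ i ∈ Finset.range L, (1 / 2 : ℝ) ^ (i + 1) ≤ 1 := by
  have : ∑ i ∈ Finset.range L, (1 / 2 : ℝ) ^ (i + 1) + (1 / 2) ^ L = 1 := by
    induction L with
    | zero => simp
    | succ L ih => rw [Finset.sum_range_succ, pow_succ]; linarith
  have h : 0 ≤ (1 / 2 : ℝ) ^ L := by positivity
  linarith

variable {V W : Type*} [Fintype V] [Fintype W]

/-- Geometrically weighted sum of the mean squared deviations at the levels `1, …, L`. -/
noncomputable def lyapunov (E : Set (V × W)) (L : ℕ) (c : ℕ → ℝ) (x : V → ℕ) : ℝ :=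
  ∑ i ∈ Finset.range L, (1 / 2 : ℝ) ^ (i + 1) * meanSqDev E (i + 1) (c (i + 1)) x

lemma lyapunov_nonneg (E : Set (V × W)) (L : ℕ) (c : ℕ → ℝ) (x : V → ℕ) : 0 ≤ lyapunov E L c x :=
  Finset.sum_nonneg fun _ _ => mul_nonneg (by positivity) (meanSqDev_nonneg _ _ _ _)

lemma nbhdFrac_zero {V W : Type*} [Fintype V] {E : Set (V × W)} {w : W} (hw : 1 ≤ typeDeg E w) (x : V → ℕ) :
    nbhdFrac E w 0 x = 1 := by
  have : (typeDeg E w : ℝ) ≠ 0 := by exact_mod_cast (by omega : typeDeg E w ≠ 0)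
  simp only [nbhdFrac, zero_le, Finset.filter_true]
  exact div_self this

/-- The growth rate of the Lyapunov function. -/
def growthRate (lam ρ : ℝ) (d : ℕ) : ℝ := 4 * (3 * lam * d ^ 2 * ρ + lam * d + 1)

/-- The error in the drift of the Lyapunov function. -/
noncomputable def driftError (lam ρ : ℝ) (d : ℕ) (φ γ : ℝ) (L : ℕ) : ℝ :=
  growthRate lam ρ d * (1 / 2) ^ L + (2 * lam * d * φ + (lam * d * ρ + 1) * γ)

lemma graphGamma_nonneg (E : Set (V × W)) : 0 ≤ graphGamma E := by
  unfold graphGamma; positivity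

lemma generatorFun_lyapunov_le {lam : ℝ} (hlam : 0 ≤ lam) {E : Set (V × W)} [Nonempty W] {d : ℕ}
    (hd : d ≠ 0) (hdeg : ∀ w, 1 ≤ typeDeg E w) {φ ρ : ℝ} (hφ0 : 0 ≤ φ) (hρ0 : 0 ≤ ρ)
    (hρ : ∀ v, serverWeight E v ≤ ρ) (hφ : ∀ v, |serverWeight E v - 1| ≤ φ) {c : ℕ → ℝ}
    (hc : ∀ i, c i ∈ Set.Icc (0 : ℝ) 1) (hc0 : c 0 = 1) (L : ℕ) (x : V → ℕ) :
    generatorFun lam E d (lyapunov E L c) x -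
      ∑ i ∈ Finset.range L, (1 / 2 : ℝ) ^ (i + 1) *
        (2 * fluidDrift lam d (c i) (c (i + 1)) (c (i + 2)) *
          ∑ w, 1 / (Fintype.card W : ℝ) * (nbhdFrac E w (i + 1) x - c (i + 1))) ≤
    growthRate lam ρ d * lyapunov E L c x + driftError lam ρ d φ (graphGamma E) L := by
  set S : ℕ → ℝ := fun i => meanSqDev E i (c i) x with hS
  have hS0 : S 0 = 0 := by
    simp only [hS, meanSqDev, hc0]
    exact Finset.sum_eq_zero fun w _ => by rw [nbhdFrac_zero (hdeg w)]; simp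
  set C := 3 * lam * d ^ 2 * ρ + lam * d + 1 with hC
  have hC0 : 0 ≤ C := by positivity
  set κ := 2 * lam * d * φ + (lam * d * ρ + 1) * graphGamma E with hκ
  have hκ0 : 0 ≤ κ := by
    have := graphGamma_nonneg E
    positivity
  have hgen : generatorFun lam E d (lyapunov E L c) x = ∑ i ∈ Finset.range L,
      (1 / 2 : ℝ) ^ (i + 1) * generatorFun lam E d (meanSqDev E (i + 1) (c (i + 1))) x :=
    generatorFun_sum _ _ _ _ _ _ _
  rw [hgen, ← Finset.sum_sub_distrib]
  have hpt : ∀ i ∈ Finset.range L,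
      (1 / 2 : ℝ) ^ (i + 1) * generatorFun lam E d (meanSqDev E (i + 1) (c (i + 1))) x -
      (1 / 2 : ℝ) ^ (i + 1) * (2 * fluidDrift lam d (c i) (c (i + 1)) (c (i + 2)) *
          ∑ w, 1 / (Fintype.card W : ℝ) * (nbhdFrac E w (i + 1) x - c (i + 1))) ≤
      C * ((1 / 2 : ℝ) ^ (i + 1) * (S i + S (i + 1) + S (i + 2))) + (1 / 2 : ℝ) ^ (i + 1) * κ := by
    intro i _
    have h1 := mul_le_mul_of_nonneg_left (generatorFun_meanSqDev_le hlam hd hdeg hρ hφ (hc i)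
      (hc (i + 1)) (c₂ := c (i + 2)) x i) (by positivity : 0 ≤ (1 / 2 : ℝ) ^ (i + 1))
    linarith
  refine (Finset.sum_le_sum hpt).trans ?_
  rw [Finset.sum_add_distrib, ← Finset.mul_sum, ← Finset.sum_mul]
  have h1 := mul_le_mul_of_nonneg_left
    (sum_geometric_mul_le hS0 (fun i => meanSqDev_nonneg _ _ _ _) L) hC0
  have h2 := mul_le_mul_of_nonneg_right (sum_half_pow_le_one L) hκ0
  have h3 : (1 / 2 : ℝ) ^ L * S (L + 1) ≤ (1 / 2 : ℝ) ^ L * 1 :=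
    mul_le_mul_of_nonneg_left (meanSqDev_le_one _ _ (hc _) _) (by positivity)
  have h4 := mul_le_mul_of_nonneg_left h3 hC0
  have h5 : 0 ≤ C * (1 / 2 : ℝ) ^ L := by positivity
  have h6 : lyapunov E L c x = ∑ i ∈ Finset.range L, (1 / 2 : ℝ) ^ (i + 1) * S (i + 1) := rfl
  rw [driftError, growthRate, ← hC, ← hκ, h6]
  linarith

/-- The mean over the task types of the `p`-th powers of the fractions, as a bounded function. -/
noncomputable def meanFrac (E : Set (V × W)) (i p : ℕ) : (V → ℕ) →ᵇ ℝ :=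
  BoundedContinuousFunction.ofNormedAddCommGroupDiscrete
    (fun x => ∑ w, 1 / (Fintype.card W : ℝ) * nbhdFrac E w i x ^ p)
    (∑ _w : W, 1 / (Fintype.card W : ℝ)) fun x => by
      refine (Finset.abs_sum_le_sum_abs _ _).trans (Finset.sum_le_sum fun w _ => ?_)
      have h := nbhdFrac_mem_Icc E w i x
      have h0 := pow_nonneg h.1 p
      rw [abs_of_nonneg (by positivity)]
      exact mul_le_of_le_one_right (by positivity) (pow_le_one₀ h.1 h.2)

lemma meanFrac_apply (E : Set (V × W)) (i p : ℕ) (x : V → ℕ) :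
    meanFrac E i p x = ∑ w, 1 / (Fintype.card W : ℝ) * nbhdFrac E w i x ^ p := rfl

/-- The Lyapunov function as a bounded function of the state. -/
noncomputable def lyapunovBCF (E : Set (V × W)) (L : ℕ) (c : ℕ → ℝ) : (V → ℕ) →ᵇ ℝ :=
  ∑ i ∈ Finset.range L, (1 / 2 : ℝ) ^ (i + 1) • (meanFrac E (i + 1) 2 -
    (2 * c (i + 1)) • meanFrac E (i + 1) 1 + (c (i + 1) ^ 2) • (1 : (V → ℕ) →ᵇ ℝ))

lemma sum_one_div_card [Nonempty W] : ∑ _w : W, 1 / (Fintype.card W : ℝ) = 1 := by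
  have : (Fintype.card W : ℝ) ≠ 0 := by exact_mod_cast Fintype.card_ne_zero
  simp [this]

lemma lyapunovBCF_apply [Nonempty W] (E : Set (V × W)) (L : ℕ) (c : ℕ → ℝ) (x : V → ℕ) :
    lyapunovBCF E L c x = lyapunov E L c x := by
  unfold lyapunovBCF lyapunov
  rw [BoundedContinuousFunction.coe_sum, Finset.sum_apply]
  refine Finset.sum_congr rfl fun i _ => ?_
  simp only [BoundedContinuousFunction.coe_smul, BoundedContinuousFunction.coe_add,
    BoundedContinuousFunction.coe_sub, Pi.add_apply, Pi.sub_apply, meanFrac_apply,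
    BoundedContinuousFunction.coe_one, Pi.one_apply, smul_eq_mul, meanSqDev]
  congr 1
  have h : c (i + 1) ^ 2 * 1 = ∑ _w : W, 1 / (Fintype.card W : ℝ) * c (i + 1) ^ 2 := by
    rw [← Finset.sum_mul, sum_one_div_card, one_mul, mul_one]
  rw [h, Finset.mul_sum, ← Finset.sum_sub_distrib, ← Finset.sum_add_distrib]
  exact Finset.sum_congr rfl fun w _ => by ring

/-- Expanding the squares separates time from state: `c` enters only through scalar coefficients of
fixed bounded functions, so the derivative exists in the supremum norm. -/
lemma hasDerivAt_lyapunovBCF (E : Set (V × W)) (L : ℕ) {c : ℝ → ℕ → ℝ} {c' : ℕ → ℝ} {u : ℝ}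
    (hc : ∀ i, HasDerivAt (fun u => c u (i + 1)) (c' i) u) :
    HasDerivAt (fun u => lyapunovBCF E L (c u))
      (∑ i ∈ Finset.range L, (1 / 2 : ℝ) ^ (i + 1) • (-((2 * c' i) • meanFrac E (i + 1) 1) +
        (2 * c u (i + 1) * c' i) • (1 : (V → ℕ) →ᵇ ℝ))) u := by
  unfold lyapunovBCF
  refine HasDerivAt.fun_sum fun i _ => ?_
  have h1 := (((hc i).const_mul 2).smul_const (meanFrac E (i + 1) 1)).const_sub
    (meanFrac E (i + 1) 2)
  have h2 := ((hc i).pow 2).smul_const (1 : (V → ℕ) →ᵇ ℝ)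
  have h3 := (h1.add h2).const_smul ((1 / 2 : ℝ) ^ (i + 1))
  refine HasDerivAt.congr_deriv h3 ?_
  simp

end Lyapunov

/-! ### Uniform-in-time smallness of the Lyapunov function. -/

section Concentration

variable {V W : Type*} [Fintype V] [Fintype W]

lemma generatorFun_const (lam : ℝ) (E : Set (V × W)) (d : ℕ) (c : ℝ) (x : V → ℕ) :
    generatorFun lam E d (fun _ => c) x = 0 := by
  simp [generatorFun]

lemma lyapunov_empty (E : Set (V × W)) (L : ℕ) {c : ℕ → ℝ} (hc : ∀ i, c (i + 1) = 0) :
    lyapunov E L c 0 = 0 := by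
  refine Finset.sum_eq_zero fun i _ => ?_
  rw [meanSqDev, hc, Finset.sum_eq_zero fun w _ => by simp [nbhdFrac], mul_zero]

/-- The Lyapunov function along a fluid solution gives a supersolution. -/
lemma isSupersolution_lyapunov {lam : ℝ} (hlam : 0 ≤ lam) {E : Set (V × W)} [Nonempty W] {d : ℕ}
    (hd : d ≠ 0) (hdeg : ∀ w, 1 ≤ typeDeg E w) {φ ρ : ℝ} (hφ0 : 0 ≤ φ) (hρ0 : 0 ≤ ρ)
    (hρ : ∀ v, serverWeight E v ≤ ρ) (hφ : ∀ v, |serverWeight E v - 1| ≤ φ) {q : ℕ → ℝ → ℝ}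
    (hq : IsFluidSolution lam d q) (L : ℕ) (T : ℝ≥0) :
    IsSupersolution lam E d T fun u =>
      Real.exp (-(growthRate lam ρ d * u)) • lyapunovBCF E L (fun i => q i u) +
        (driftError lam ρ d φ (graphGamma E) L * (T - u)) • (1 : (V → ℕ) →ᵇ ℝ) := by
  -- The factor `e^{-κ u}` cancels the growth `κ Φ`, and the slope `-ε` of the second summand
  -- absorbs `e^{-κ u} ε ≤ ε`; the summand vanishes at `T`, so the whole stays nonnegative.
  set κ := growthRate lam ρ d with hκ
  set ε := driftError lam ρ d φ (graphGamma E) L with hε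
  have hκ0 : 0 ≤ κ := by rw [hκ, growthRate]; positivity
  have hε0 : 0 ≤ ε := by
    have := graphGamma_nonneg E
    rw [hε, driftError, ← hκ]; positivity
  set D : ℝ → (V → ℕ) →ᵇ ℝ := fun u =>
    ∑ i ∈ Finset.range L, (1 / 2 : ℝ) ^ (i + 1) •
      (-((2 * fluidDrift lam d (q i u) (q (i + 1) u) (q (i + 2) u)) • meanFrac E (i + 1) 1) +
        (2 * q (i + 1) u * fluidDrift lam d (q i u) (q (i + 1) u) (q (i + 2) u)) •
          (1 : (V → ℕ) →ᵇ ℝ)) with hD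
  intro s t hs hst ht x
  refine opSemigroup_le_of_deriv_add_generator_nonpos hlam E d (T := T)
    (fun u => Real.exp (-(κ * u)) • lyapunovBCF E L (fun i => q i u) +
      (ε * (T - u)) • (1 : (V → ℕ) →ᵇ ℝ))
    (fun u => (Real.exp (-(κ * u)) • D u + (Real.exp (-(κ * u)) * -κ) •
      lyapunovBCF E L (fun i => q i u)) + (-ε) • (1 : (V → ℕ) →ᵇ ℝ)) ?_ ?_ ?_ hs hst ht x
  · have h1 : ∀ i, ContinuousOn (fun u => q (i + 1) u) (Set.Icc 0 T) := fun i u hu =>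
      ((hq.ode i u hu.1).mono Set.Icc_subset_Ici_self).continuousWithinAt
    unfold lyapunovBCF
    fun_prop
  · intro u hu
    have h1 : ∀ i, HasDerivAt (fun u => q (i + 1) u)
        (fluidDrift lam d (q i u) (q (i + 1) u) (q (i + 2) u)) u := fun i =>
      (hq.ode i u hu.1.le).hasDerivAt (Ici_mem_nhds hu.1)
    have h2 := hasDerivAt_lyapunovBCF E L (c := fun u i => q i u) h1
    have h3 : HasDerivAt (fun u => Real.exp (-(κ * u))) (Real.exp (-(κ * u)) * -κ) u := by
      have := (((hasDerivAt_id u).const_mul κ).neg).exp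
      simpa using this
    have h4 : HasDerivAt (fun u => ε * (T - u)) (-ε) u := by
      have := ((hasDerivAt_id u).const_sub (T : ℝ)).const_mul ε
      simpa using this
    exact (h3.smul h2).add (h4.smul_const (1 : (V → ℕ) →ᵇ ℝ))
  · intro u hu y
    have hgen : generatorFun lam E d (Real.exp (-(κ * u)) • lyapunovBCF E L (fun i => q i u) +
        (ε * (T - u)) • (1 : (V → ℕ) →ᵇ ℝ) : (V → ℕ) →ᵇ ℝ) y =
        Real.exp (-(κ * u)) * generatorFun lam E d (lyapunov E L fun i => q i u) y := by
      rw [← generator_apply, map_add, map_smul, map_smul]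
      have h1 : generator lam E d (1 : (V → ℕ) →ᵇ ℝ) = 0 := by
        ext z
        exact generatorFun_const lam E d 1 z
      have h2 : ⇑(lyapunovBCF E L fun i => q i u) = lyapunov E L fun i => q i u :=
        funext fun z => lyapunovBCF_apply E L _ z
      rw [h1, smul_zero, add_zero, BoundedContinuousFunction.coe_smul, ← h2]
      rfl
    have hDy : D u y = -∑ i ∈ Finset.range L, (1 / 2 : ℝ) ^ (i + 1) *
        (2 * fluidDrift lam d (q i u) (q (i + 1) u) (q (i + 2) u) *
          ∑ w, 1 / (Fintype.card W : ℝ) * (nbhdFrac E w (i + 1) y - q (i + 1) u)) := by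
      rw [hD, BoundedContinuousFunction.coe_sum, Finset.sum_apply, ← Finset.sum_neg_distrib]
      refine Finset.sum_congr rfl fun i _ => ?_
      have h1 : ∑ w, 1 / (Fintype.card W : ℝ) * (nbhdFrac E w (i + 1) y - q (i + 1) u) =
          (∑ w, 1 / (Fintype.card W : ℝ) * nbhdFrac E w (i + 1) y ^ 1) - q (i + 1) u := by
        simp only [pow_one, mul_sub, Finset.sum_sub_distrib]
        rw [← Finset.sum_mul, sum_one_div_card, one_mul]
      rw [h1]
      simp only [BoundedContinuousFunction.coe_smul, BoundedContinuousFunction.coe_add,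
        BoundedContinuousFunction.coe_neg, Pi.add_apply, Pi.neg_apply, meanFrac_apply,
        BoundedContinuousFunction.coe_one, Pi.one_apply, smul_eq_mul]
      ring
    have hmain := generatorFun_lyapunov_le hlam hd hdeg hφ0 hρ0 hρ hφ
      (c := fun i => q i u) (fun i => hq.mem_Icc i u hu.1.le) (hq.zero_eq_one u hu.1.le) L y
    rw [hgen]
    simp only [BoundedContinuousFunction.coe_smul, BoundedContinuousFunction.coe_add,
      Pi.add_apply, BoundedContinuousFunction.coe_one, Pi.one_apply, smul_eq_mul,
      lyapunovBCF_apply, hDy, mul_one]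
    rw [← hκ, ← hε] at hmain
    have h1 := mul_le_mul_of_nonneg_left hmain (Real.exp_nonneg (-(κ * u)))
    have h2 : Real.exp (-(κ * u)) ≤ 1 := Real.exp_le_one_iff.2 (by
      have := mul_nonneg hκ0 hu.1.le
      linarith)
    have h3 := mul_le_mul_of_nonneg_right h2 hε0
    linarith

variable {Ω : Type*} [MeasurableSpace Ω] {P : Measure Ω} [IsProbabilityMeasure P]

/-- The Lyapunov function stays small with high probability. -/
lemma measure_exists_lt_lyapunov_le {lam : ℝ} (hlam : 0 ≤ lam) {E : Set (V × W)} [Nonempty W]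
    {d : ℕ} (hd : d ≠ 0) (hdeg : ∀ w, 1 ≤ typeDeg E w) {φ ρ : ℝ} (hφ0 : 0 ≤ φ) (hρ0 : 0 ≤ ρ)
    (hρ : ∀ v, serverWeight E v ≤ ρ) (hφ : ∀ v, |serverWeight E v - 1| ≤ φ) {q : ℕ → ℝ → ℝ}
    (hq : IsFluidSolution lam d q) {X : ℝ≥0 → Ω → V → ℕ} (hX : IsQueueLengthProcess P lam E d X)
    (hX0 : ∀ᵐ ω ∂P, X 0 ω = 0) (L : ℕ) (T : ℝ≥0) {a : ℝ} (ha : 0 < a) :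
    P {ω | ∃ s ≤ T, a < lyapunov E L (fun i => q i s) (X s ω)} ≤
      ENNReal.ofReal (driftError lam ρ d φ (graphGamma E) L * T *
        Real.exp (growthRate lam ρ d * T) / a) := by
  have hZ := isSupersolution_lyapunov hlam hd hdeg hφ0 hρ0 hρ hφ hq L T
  set κ := growthRate lam ρ d with hκ
  set ε := driftError lam ρ d φ (graphGamma E) L with hε
  have hκ0 : 0 ≤ κ := by rw [hκ, growthRate]; positivity
  have hε0 : 0 ≤ ε := by
    have := graphGamma_nonneg E
    rw [hε, driftError, ← hκ]; positivity
  have happ : ∀ u x, (Real.exp (-(κ * u)) • lyapunovBCF E L (fun i => q i u) +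
      (ε * (T - u)) • (1 : (V → ℕ) →ᵇ ℝ) : (V → ℕ) →ᵇ ℝ) x =
      Real.exp (-(κ * u)) * lyapunov E L (fun i => q i u) x + ε * (T - u) := by
    intro u x
    simp [lyapunovBCF_apply]
  -- If the Lyapunov function exceeds `a` by time `T`, the supersolution exceeds `a e^{-κ T}`. Its
  -- initial mean is `ε T`, since the Lyapunov function vanishes at the empty state.
  have hmax := hZ.maximal hX (fun s hs x => by
      rw [happ]
      have h1 := lyapunov_nonneg E L (fun i => q i s) x
      have h2 : 0 ≤ (T : ℝ) - s := sub_nonneg.2 hs.2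
      positivity) (fun x => by
      have h1 : ∀ i, ContinuousOn (fun u => q (i + 1) u) (Set.Icc 0 T) := fun i u hu =>
        ((hq.ode i u hu.1).mono Set.Icc_subset_Ici_self).continuousWithinAt
      simp only [happ, lyapunov, meanSqDev]
      fun_prop) (a := a * Real.exp (-(κ * T))) (by positivity)
  refine (measure_mono ?_).trans (hmax.trans (le_of_eq ?_))
  · rintro ω ⟨s, hs, hlt⟩
    refine ⟨s, hs, ?_⟩
    rw [happ]
    have hs' : (s : ℝ) ≤ T := by exact_mod_cast hs
    have h1 : Real.exp (-(κ * T)) ≤ Real.exp (-(κ * s)) :=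
      Real.exp_le_exp.2 (by have := mul_le_mul_of_nonneg_left hs' hκ0; linarith)
    have h2 : 0 ≤ ε * (T - s) := mul_nonneg hε0 (sub_nonneg.2 hs')
    have h3 := mul_lt_mul_of_pos_right hlt (Real.exp_pos (-(κ * s)))
    have h4 := mul_le_mul_of_nonneg_left h1 ha.le
    linarith
  · congr 1
    have h1 : ∫ ω, (Real.exp (-(κ * (0 : ℝ))) • lyapunovBCF E L (fun i => q i 0) +
      (ε * (T - 0)) • (1 : (V → ℕ) →ᵇ ℝ) : (V → ℕ) →ᵇ ℝ) (X 0 ω) ∂P = ε * T := by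
      rw [integral_congr_ae (g := fun _ => ε * T)]
      · simp
      · filter_upwards [hX0] with ω hω
        rw [happ, hω, lyapunov_empty E L hq.init]
        simp
    rw [h1, Real.exp_neg]
    have := Real.exp_pos (κ * T)
    field_simp

end Concentration

/-! ### Exponential control of the number of tasks per server. -/

section Load

variable {V : Type*} [Fintype V]

/-- The number of tasks per server. -/
noncomputable def load (x : V → ℕ) : ℝ := (∑ v, (x v : ℝ)) / (Fintype.card V : ℝ)

lemma load_nonneg (x : V → ℕ) : 0 ≤ load x := by
  unfold load; positivity

open Classical in
lemma load_update (x : V → ℕ) (v : V) (n : ℕ) :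
    load (Function.update x v n) = load x + ((n : ℝ) - x v) / Fintype.card V := by
  have h : ∑ u, ((Function.update x v n u : ℕ) : ℝ) = ∑ u, (x u : ℝ) + ((n : ℝ) - x v) := by
    rw [← sub_eq_iff_eq_add', ← Finset.sum_sub_distrib, Finset.sum_eq_single v]
    · simp
    · intro u _ hu
      simp [Function.update_of_ne hu]
    · simp
  unfold load
  rw [h, add_div]

lemma occupancy_mem_Icc (x : V → ℕ) (i : ℕ) : occupancy x i ∈ Set.Icc (0 : ℝ) 1 := by
  refine ⟨by unfold occupancy; positivity, div_le_one_of_le₀ ?_ (by positivity)⟩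
  exact_mod_cast Finset.card_filter_le _ _

lemma occupancy_succ_le (x : V → ℕ) (i : ℕ) : occupancy x (i + 1) ≤ load x / (i + 1) := by
  unfold occupancy load
  rw [div_div, mul_comm (Fintype.card V : ℝ), ← div_div]
  refine div_le_div_of_nonneg_right ?_ (by positivity)
  rw [le_div_iff₀ (by positivity)]
  calc ((Finset.univ.filter fun v => i + 1 ≤ x v).card : ℝ) * (i + 1)
      = ∑ v ∈ Finset.univ.filter (fun v => i + 1 ≤ x v), ((i : ℝ) + 1) := by
        rw [Finset.sum_const, nsmul_eq_mul]
    _ ≤ ∑ v ∈ Finset.univ.filter (fun v => i + 1 ≤ x v), (x v : ℝ) :=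
        Finset.sum_le_sum fun v hv => by exact_mod_cast (Finset.mem_filter.1 hv).2
    _ ≤ _ := Finset.sum_le_sum_of_subset_of_nonneg (Finset.filter_subset _ _)
        fun _ _ _ => by positivity

/-- The truncated exponential of the load. -/
noncomputable def expLoad (V : Type*) [Fintype V] (b : ℝ) : (V → ℕ) →ᵇ ℝ :=
  BoundedContinuousFunction.ofNormedAddCommGroupDiscrete (fun x => min (Real.exp (load x)) |b|) |b|
    fun x => by
      rw [Real.norm_eq_abs, abs_of_nonneg (le_min (Real.exp_nonneg _) (abs_nonneg _))]
      exact min_le_right _ _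

lemma expLoad_apply (b : ℝ) (x : V → ℕ) : expLoad V b x = min (Real.exp (load x)) |b| := rfl

variable {W : Type*} [Fintype W]

/-- An arrival multiplies the exponential by `e^{1/n} ≤ 1 + 2/n`, and since this factor is at least
1 the truncation respects the bound. Departures only decrease it. With `n` servers, each of arrival
rate at most `lam * d * ρ`, the growth rate does not depend on `n`. -/
lemma generatorFun_expLoad_le {lam : ℝ} (hlam : 0 ≤ lam) {E : Set (V × W)} {d : ℕ} (hd : d ≠ 0)
    [Nonempty V] {ρ : ℝ} (hρ : ∀ v, serverWeight E v ≤ ρ) (b : ℝ) (x : V → ℕ) :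
    generatorFun lam E d (expLoad V b) x ≤ 2 * (lam * d * ρ) * expLoad V b x := by
  classical
  set n : ℝ := (Fintype.card V : ℝ) with hn
  have hn1 : 1 ≤ n := by rw [hn]; exact_mod_cast Fintype.card_pos
  set H := expLoad V b x with hH
  have hH0 : 0 ≤ H := le_min (Real.exp_nonneg _) (abs_nonneg _)
  have hup : ∀ v, expLoad V b (Function.update x v (x v + 1)) - H ≤ 2 / n * H := by
    intro v
    have h1 : load (Function.update x v (x v + 1)) = load x + 1 / n := by
      rw [load_update]; push_cast; ring
    have h2 : Real.exp (1 / n) ≤ 1 + 2 / n := by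
      have h3 : |1 / n| ≤ 1 := by
        rw [abs_of_nonneg (by positivity)]
        exact div_le_one_of_le₀ hn1 (by linarith)
      have h4 := Real.abs_exp_sub_one_le h3
      rw [abs_of_nonneg (by positivity : 0 ≤ 1 / n)] at h4
      have h5 := (abs_le.1 h4).2
      have h6 : 2 / n = 2 * (1 / n) := by ring
      linarith
    have h3 : expLoad V b (Function.update x v (x v + 1)) ≤ Real.exp (1 / n) * H := by
      rw [expLoad_apply, h1, Real.exp_add, hH, expLoad_apply, mul_min_of_nonneg _ _ (Real.exp_nonneg _)]
      refine min_le_min (le_of_eq (mul_comm _ _)) ?_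
      exact le_mul_of_one_le_left (abs_nonneg _) (Real.one_le_exp (by positivity))
    have h4 := mul_le_mul_of_nonneg_right h2 hH0
    linarith
  have hdown : ∀ v, expLoad V b (Function.update x v (x v - 1)) - H ≤ 0 := by
    intro v
    rw [sub_nonpos, hH, expLoad_apply, expLoad_apply]
    refine min_le_min_right _ (Real.exp_le_exp.2 ?_)
    rw [load_update]
    have h1 : ((x v - 1 : ℕ) : ℝ) ≤ x v := by exact_mod_cast Nat.sub_le _ _
    have h2 : (((x v - 1 : ℕ) : ℝ) - x v) / (Fintype.card V : ℝ) ≤ 0 :=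
      div_nonpos_of_nonpos_of_nonneg (by linarith) (by positivity)
    linarith
  rw [generatorFun_eq]
  have hpt : ∀ v ∈ Finset.univ, (arrivalRate lam E d x v *
      (expLoad V b (Function.update x v (x v + 1)) - expLoad V b x) +
      if 0 < x v then expLoad V b (Function.update x v (x v - 1)) - expLoad V b x else 0) ≤
      (lam * d * ρ) * (2 / n * H) := by
    intro v _
    have e1 := arrivalRate_le hlam (E := E) hd x v
    have e2 := mul_le_mul_of_nonneg_left (hρ v) (by positivity : 0 ≤ lam * (d : ℝ))
    have e3 := arrivalRate_nonneg hlam E d x v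
    have h1 : arrivalRate lam E d x v * (expLoad V b (Function.update x v (x v + 1)) - H) ≤
        (lam * d * ρ) * (2 / n * H) :=
      (mul_le_mul_of_nonneg_left (hup v) e3).trans
        (mul_le_mul_of_nonneg_right (by linarith) (by positivity))
    have h2 : (if 0 < x v then expLoad V b (Function.update x v (x v - 1)) - H else 0) ≤ 0 := by
      split_ifs
      · exact hdown v
      · exact le_rfl
    linarith
  refine (Finset.sum_le_card_nsmul _ _ _ hpt).trans (le_of_eq ?_)
  rw [nsmul_eq_mul, Finset.card_univ, ← hn]
  field_simp

variable {Ω : Type*} [MeasurableSpace Ω] {P : Measure Ω} [IsProbabilityMeasure P]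

lemma measure_exists_lt_exp_load_le {lam : ℝ} (hlam : 0 ≤ lam) {E : Set (V × W)} {d : ℕ}
    (hd : d ≠ 0) [Nonempty V] {ρ : ℝ} (hρ : ∀ v, serverWeight E v ≤ ρ) {X : ℝ≥0 → Ω → V → ℕ}
    (hX : IsQueueLengthProcess P lam E d X) (hX0 : ∀ᵐ ω ∂P, X 0 ω = 0) (T : ℝ≥0) {a : ℝ}
    (ha : 0 < a) :
    P {ω | ∃ s ≤ T, a < Real.exp (load (X s ω))} ≤
      ENNReal.ofReal (Real.exp (2 * (lam * d * ρ) * T) / a) := by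
  set κ := 2 * (lam * d * ρ) with hκ
  -- The truncation level lies above `a`, so truncating does not affect exceedance of `a`.
  set b := a + 1 with hb
  have hb0 : 0 < b := by linarith
  have hκ0 : 0 ≤ κ := by
    obtain ⟨v⟩ := ‹Nonempty V›
    have : 0 ≤ ρ := le_trans (by unfold serverWeight; positivity) (hρ v)
    rw [hκ]; positivity
  have hexp : ∀ u, HasDerivAt (fun u => Real.exp (-(κ * u))) (Real.exp (-(κ * u)) * -κ) u := by
    intro u
    have := (((hasDerivAt_id u).const_mul κ).neg).exp
    simpa using this
  have hH0 : ∀ x, 0 ≤ expLoad V b x := fun x => le_min (Real.exp_nonneg _) (abs_nonneg _)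
  have hZ : IsSupersolution lam E d T fun u => Real.exp (-(κ * u)) • expLoad V b := by
    intro s t hs hst ht x
    refine opSemigroup_le_of_deriv_add_generator_nonpos hlam E d (T := T)
      (fun u => Real.exp (-(κ * u)) • expLoad V b)
      (fun u => (Real.exp (-(κ * u)) * -κ) • expLoad V b) ?_ ?_ ?_ hs hst ht x
    · fun_prop
    · exact fun u _ => (hexp u).smul_const (expLoad V b)
    · intro u _ y
      have hgen : generatorFun lam E d (Real.exp (-(κ * u)) • expLoad V b : (V → ℕ) →ᵇ ℝ) y =
          Real.exp (-(κ * u)) * generatorFun lam E d (expLoad V b) y := by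
        rw [← generator_apply, map_smul]
        rfl
      rw [hgen]
      have h1 := mul_le_mul_of_nonneg_left (generatorFun_expLoad_le hlam hd hρ b y)
        (Real.exp_nonneg (-(κ * u)))
      simp only [BoundedContinuousFunction.coe_smul, smul_eq_mul]
      rw [← hκ] at h1
      linarith
  have hmax := hZ.maximal hX (fun s _ x => mul_nonneg (Real.exp_nonneg _) (hH0 x))
    (fun x => by simp only [BoundedContinuousFunction.coe_smul]; fun_prop)
    (a := a * Real.exp (-(κ * T))) (by positivity)
  refine (measure_mono ?_).trans (hmax.trans (ENNReal.ofReal_le_ofReal ?_))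
  · rintro ω ⟨s, hs, hlt⟩
    refine ⟨s, hs, ?_⟩
    have hs' : (s : ℝ) ≤ T := by exact_mod_cast hs
    have h1 : Real.exp (-(κ * T)) ≤ Real.exp (-(κ * s)) :=
      Real.exp_le_exp.2 (by have := mul_le_mul_of_nonneg_left hs' hκ0; linarith)
    have h2 : a < expLoad V b (X s ω) := by
      rw [expLoad_apply, abs_of_pos hb0]
      exact lt_min hlt (by linarith)
    have h3 := mul_lt_mul_of_pos_right h2 (Real.exp_pos (-(κ * s)))
    have h4 := mul_le_mul_of_nonneg_left h1 ha.le
    simp only [BoundedContinuousFunction.coe_smul, smul_eq_mul]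
    linarith
  · have h1 : ∫ ω, (Real.exp (-(κ * (0 : ℝ))) • expLoad V b : (V → ℕ) →ᵇ ℝ) (X 0 ω) ∂P ≤ 1 := by
      have h2 : ∫ ω, (Real.exp (-(κ * (0 : ℝ))) • expLoad V b : (V → ℕ) →ᵇ ℝ) (X 0 ω) ∂P ≤
          ∫ _ω, (1 : ℝ) ∂P := by
        refine integral_mono_ae (integrable_comp_process hX 0 _) (integrable_const _) ?_
        filter_upwards [hX0] with ω hω
        simp only [BoundedContinuousFunction.coe_smul, smul_eq_mul, hω, expLoad_apply]
        simp [load]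
      simpa using h2
    have h2 : Real.exp (κ * T) / a = 1 / (a * Real.exp (-(κ * T))) := by
      rw [Real.exp_neg]
      have := Real.exp_pos (κ * T)
      field_simp
    rw [h2]
    exact div_le_div_of_nonneg_right h1 (by positivity)

end Load

/-! ### From the fractions seen by types to the global occupancy. -/

section Occupancy

variable {V W : Type*} [Fintype V] [Fintype W]

/-- By double counting, the mean over types counts each server `v` with weight `serverWeight E v /
N` in place of `1 / N`. -/
lemma abs_mean_nbhdFrac_sub_occupancy_le {E : Set (V × W)} {φ : ℝ} (hφ0 : 0 ≤ φ)
    (hφ : ∀ v, |serverWeight E v - 1| ≤ φ) [Nonempty V] (i : ℕ) (x : V → ℕ) :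
    |∑ w, 1 / (Fintype.card W : ℝ) * nbhdFrac E w i x - occupancy x i| ≤ φ := by
  classical
  set n : ℝ := (Fintype.card V : ℝ) with hn
  have hn0 : 0 < n := by rw [hn]; exact_mod_cast Fintype.card_pos
  set m : ℝ := 1 / (Fintype.card W : ℝ) with hm
  have h1 : ∑ w, m * nbhdFrac E w i x =
      ∑ v, 1 / n * (serverWeight E v * if i ≤ x v then (1 : ℝ) else 0) := by
    simp only [nbhdFrac_eq_sum, Finset.mul_sum]
    rw [sum_typeNbhd_comm E fun w v => m * (1 / (typeDeg E w : ℝ) * if i ≤ x v then (1 : ℝ) else 0)]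
    refine Finset.sum_congr rfl fun v _ => ?_
    rw [serverWeight, ← hn, ← Finset.mul_sum, ← Finset.sum_mul, hm]
    field_simp
  have h2 : occupancy x i = ∑ v, 1 / n * if i ≤ x v then (1 : ℝ) else 0 := by
    rw [occupancy, Finset.card_filter, ← Finset.mul_sum, ← hn]
    push_cast
    ring
  rw [h1, h2, ← Finset.sum_sub_distrib]
  refine (Finset.abs_sum_le_sum_abs _ _).trans ?_
  refine (Finset.sum_le_card_nsmul _ _ (1 / n * φ) fun v _ => ?_).trans (le_of_eq ?_)
  · rw [← mul_sub, abs_mul, abs_of_nonneg (by positivity : 0 ≤ 1 / n)]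
    refine mul_le_mul_of_nonneg_left ?_ (by positivity)
    split_ifs
    · simpa using hφ v
    · simpa using hφ0
  · rw [nsmul_eq_mul, Finset.card_univ, ← hn]
    field_simp

lemma sq_occupancy_sub_le {E : Set (V × W)} {φ : ℝ} (hφ0 : 0 ≤ φ)
    (hφ : ∀ v, |serverWeight E v - 1| ≤ φ) [Nonempty V] [Nonempty W] (i : ℕ) (x : V → ℕ) (c : ℝ) :
    (occupancy x i - c) ^ 2 ≤ 2 * meanSqDev E i c x + 2 * φ ^ 2 := by
  set m : ℝ := 1 / (Fintype.card W : ℝ) with hm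
  have hm0 : 0 ≤ m := by positivity
  have hsum : ∑ _w : W, m = 1 := sum_one_div_card
  set μ := ∑ w, m * nbhdFrac E w i x with hμ
  have h1 := abs_mean_nbhdFrac_sub_occupancy_le hφ0 hφ i x
  rw [← hm, ← hμ] at h1
  have h2 : μ - c = ∑ w, m * (nbhdFrac E w i x - c) := by
    simp only [mul_sub, Finset.sum_sub_distrib]
    rw [← Finset.sum_mul, hsum, one_mul]
  -- Jensen's inequality, in the form that the variance over the types is nonnegative.
  have h3 : (μ - c) ^ 2 ≤ meanSqDev E i c x := by
    have h4 : ∑ w, m * ((nbhdFrac E w i x - c) - (μ - c)) ^ 2 =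
        meanSqDev E i c x - (μ - c) ^ 2 := by
      have e : ∀ w, m * ((nbhdFrac E w i x - c) - (μ - c)) ^ 2 =
          m * (nbhdFrac E w i x - c) ^ 2 - 2 * (μ - c) * (m * (nbhdFrac E w i x - c)) +
            (μ - c) ^ 2 * m := fun w => by ring
      rw [Finset.sum_congr rfl fun w _ => e w, Finset.sum_add_distrib, Finset.sum_sub_distrib,
        ← Finset.mul_sum _ _ (2 * (μ - c)), ← h2, ← Finset.mul_sum _ _ ((μ - c) ^ 2), hsum,
        meanSqDev]
      ring
    have h5 : 0 ≤ ∑ w, m * ((nbhdFrac E w i x - c) - (μ - c)) ^ 2 :=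
      Finset.sum_nonneg fun w _ => by positivity
    linarith
  have h4 : (μ - occupancy x i) ^ 2 ≤ φ ^ 2 := sq_le_sq' (abs_le.1 h1).1 (abs_le.1 h1).2
  nlinarith [sq_nonneg ((μ - c) + (μ - occupancy x i))]

lemma meanSqDev_le_lyapunov (E : Set (V × W)) {L i : ℕ} (hi : i < L) (c : ℕ → ℝ) (x : V → ℕ) :
    meanSqDev E (i + 1) (c (i + 1)) x ≤ 2 ^ (i + 1) * lyapunov E L c x := by
  have h := Finset.single_le_sum (f := fun i => (1 / 2 : ℝ) ^ (i + 1) *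
    meanSqDev E (i + 1) (c (i + 1)) x) (fun i _ => mul_nonneg (by positivity)
    (meanSqDev_nonneg _ _ _ _)) (Finset.mem_range.2 hi)
  have h1 := mul_le_mul_of_nonneg_left h (by positivity : (0 : ℝ) ≤ 2 ^ (i + 1))
  have h2 : (2 : ℝ) ^ (i + 1) * (1 / 2) ^ (i + 1) = 1 := by rw [← mul_pow]; norm_num
  calc _ = (2 : ℝ) ^ (i + 1) * (1 / 2) ^ (i + 1) * meanSqDev E (i + 1) (c (i + 1)) x := by
        rw [h2, one_mul]
    _ ≤ _ := by rw [mul_assoc]; exact h1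

end Occupancy

/-! ### Expected supremum: finitely many levels plus a summable tail. -/

section Bound

variable {V W : Type*} [Fintype V] [Fintype W] {Ω : Type*} [MeasurableSpace Ω] {P : Measure Ω}

/-- The tails of `∑ 1 / (i + 1) ^ 2`. -/
noncomputable def invSqTail (k : ℕ) : ℝ≥0∞ := ∑' i : ℕ, ENNReal.ofReal (1 / ((i + k : ℕ) + 1 : ℝ) ^ 2)

lemma invSqTail_zero_ne_top : invSqTail 0 ≠ ∞ := by
  have h : Summable fun i : ℕ => 1 / ((i + 0 : ℕ) + 1 : ℝ) ^ 2 := by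
    have h1 := (summable_nat_add_iff 1).2 (Real.summable_one_div_nat_pow.2 one_lt_two)
    refine h1.congr fun i => ?_
    push_cast
    ring
  exact h.tsum_ofReal_ne_top

lemma tendsto_invSqTail : Tendsto invSqTail atTop (𝓝 0) :=
  ENNReal.tendsto_sum_nat_add (fun i : ℕ => ENNReal.ofReal (1 / ((i : ℕ) + 1 : ℝ) ^ 2))
    invSqTail_zero_ne_top

/-- If the supremum of the load has exponential moments, its square has a dominating function with
bounded mean. -/
lemma exists_dominating_sq_load {X : ℝ≥0 → Ω → V → ℕ} {T : ℝ≥0} {K : ℝ} (hK : 0 ≤ K)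
    (hload : ∀ a : ℝ, 0 < a →
      P {ω | ∃ s ≤ T, a < Real.exp (load (X s ω))} ≤ ENNReal.ofReal (K / a)) :
    ∃ G : Ω → ℝ≥0∞, Measurable G ∧ ∫⁻ ω, G ω ∂P ≤ ENNReal.ofReal K * invSqTail 0 ∧
      ∀ ω, ∀ s ≤ T, ENNReal.ofReal (load (X s ω) ^ 2) ≤ 8 * (1 + G ω) := by
  -- The squares `(n + 1)²` make the probabilities `K / (n + 1)²` summable. Measurable hulls avoid
  -- the measurability of suprema over uncountably many times.
  set S : ℕ → Set Ω := fun n => toMeasurable P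
    {ω | ∃ s ≤ T, ((n : ℝ) + 1) ^ 2 < Real.exp (load (X s ω))} with hS
  have hSm : ∀ n, MeasurableSet (S n) := fun n => measurableSet_toMeasurable _ _
  refine ⟨fun ω => ∑' n, (S n).indicator 1 ω,
    Measurable.tsum fun n => measurable_one.indicator (hSm n), ?_, ?_⟩
  · rw [lintegral_tsum fun n => (measurable_one.indicator (hSm n)).aemeasurable, invSqTail,
      ← ENNReal.tsum_mul_left]
    refine ENNReal.tsum_le_tsum fun n => ?_
    rw [lintegral_indicator_one (hSm n), hS, measure_toMeasurable,
      ← ENNReal.ofReal_mul hK]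
    refine (hload _ (by positivity)).trans (le_of_eq ?_)
    congr 1
    push_cast
    ring
  · intro ω s hs
    set Y := load (X s ω) with hY
    have hY0 : 0 ≤ Y := load_nonneg _
    set y := Real.exp (Y / 2) with hy
    have hy2 : y ^ 2 = Real.exp Y := by
      rw [hy, ← Real.exp_nat_mul]; congr 1; push_cast; ring
    -- From `(Y/2)² / 2 ≤ e^{Y/2}`. It remains to bound `y = e^{Y/2}` by counting the `n` with `n +
    -- 1 < y`, for each of which `ω ∈ S n`.
    have h1 : Y ^ 2 ≤ 8 * y := by
      have := Real.quadratic_le_exp_of_nonneg (x := Y / 2) (by positivity)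
      nlinarith
    have h2 : ENNReal.ofReal y ≤ 1 + ∑' n, (S n).indicator 1 ω := by
      have h3 : ∀ n ∈ Finset.range (⌈y⌉₊ - 1), (1 : ℝ≥0∞) ≤ (S n).indicator 1 ω := by
        intro n hn
        have h4 : n + 1 < ⌈y⌉₊ := by have := Finset.mem_range.1 hn; omega
        have h5 : (n : ℝ) + 1 < y := by exact_mod_cast Nat.lt_ceil.1 h4
        have h6 : ω ∈ S n := by
          refine subset_toMeasurable _ _ ⟨s, hs, ?_⟩
          rw [← hY, ← hy2]
          gcongr
        rw [Set.indicator_of_mem h6]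
        rfl
      have h4 := (Finset.card_nsmul_le_sum _ _ _ h3).trans (ENNReal.sum_le_tsum _)
      rw [Finset.card_range, nsmul_eq_mul, mul_one] at h4
      calc ENNReal.ofReal y ≤ ENNReal.ofReal (⌈y⌉₊ : ℝ) :=
            ENNReal.ofReal_le_ofReal (Nat.le_ceil y)
        _ = (⌈y⌉₊ : ℝ≥0∞) := ENNReal.ofReal_natCast _
        _ ≤ ((1 + (⌈y⌉₊ - 1) : ℕ) : ℝ≥0∞) := by exact_mod_cast (by omega)
        _ = 1 + ((⌈y⌉₊ - 1 : ℕ) : ℝ≥0∞) := by push_cast; rfl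
        _ ≤ _ := by gcongr
    calc ENNReal.ofReal (Y ^ 2) ≤ ENNReal.ofReal (8 * y) := ENNReal.ofReal_le_ofReal h1
      _ = 8 * ENNReal.ofReal y := by
        rw [ENNReal.ofReal_mul (by norm_num)]; norm_num
      _ ≤ _ := by gcongr

/-- Bound of the mean supremal squared distance in terms of the deviation probabilities. -/
lemma lintegral_iSup_sq_le [IsProbabilityMeasure P] [Nonempty V] [Nonempty W] {E : Set (V × W)}
    {φ : ℝ} (hφ0 : 0 ≤ φ)
    (hφ : ∀ v, |serverWeight E v - 1| ≤ φ) {q : ℕ → ℝ → ℝ}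
    {X : ℝ≥0 → Ω → V → ℕ} {T : ℝ≥0} (hq : ∀ i, ∀ s ≤ T, q i (s : ℝ≥0) ∈ Set.Icc (0 : ℝ) 1) {A : ℝ}
    (hA : ∀ j : ℕ, ∀ s ≤ T, q (j + 1) (s : ℝ≥0) ≤ A / (j + 1)) {K : ℝ} (hK : 0 ≤ K)
    (hload : ∀ a : ℝ, 0 < a →
      P {ω | ∃ s ≤ T, a < Real.exp (load (X s ω))} ≤ ENNReal.ofReal (K / a))
    {k L : ℕ} (hkL : k ≤ L) {a : ℝ} :
    ∫⁻ ω, ⨆ s : Set.Icc (0 : ℝ≥0) T, ∑' i : ℕ, ENNReal.ofReal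
        ((occupancy (X s ω) (i + 1) - q (i + 1) ((s : ℝ≥0) : ℝ)) ^ 2) ∂P ≤
      k * P {ω | ∃ s ≤ T, a < lyapunov E L (fun i => q i s) (X s ω)} +
        k * ENNReal.ofReal (2 * (2 ^ k * a) + 2 * φ ^ 2) +
        invSqTail k * (16 * (1 + ENNReal.ofReal K * invSqTail 0) + ENNReal.ofReal (2 * A ^ 2)) := by
  obtain ⟨G, hGm, hGi, hG⟩ := exists_dominating_sq_load hK hload
  set B := toMeasurable P {ω | ∃ s ≤ T, a < lyapunov E L (fun i => q i s) (X s ω)} with hB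
  have hBm : MeasurableSet B := measurableSet_toMeasurable _ _
  -- Levels `1, …, k` are bounded by 1 on the bad event and by the Lyapunov function off it. Beyond
  -- level `k`, both occupancy and fluid value are of order `1 / (j + 1)`. Only the dominating
  -- function has to be measurable.
  have hpt : ∀ ω, (⨆ s : Set.Icc (0 : ℝ≥0) T, ∑' i : ℕ, ENNReal.ofReal
        ((occupancy (X s ω) (i + 1) - q (i + 1) ((s : ℝ≥0) : ℝ)) ^ 2)) ≤
      k * B.indicator 1 ω + k * ENNReal.ofReal (2 * (2 ^ k * a) + 2 * φ ^ 2) +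
        invSqTail k * (16 * (1 + G ω) + ENNReal.ofReal (2 * A ^ 2)) := by
    intro ω
    refine iSup_le fun ⟨s, hs⟩ => ?_
    have hsT := hs.2
    rw [← Summable.sum_add_tsum_nat_add' (k := k) ENNReal.summable]
    refine add_le_add ?_ ?_
    · rw [← mul_add]
      refine (Finset.sum_le_card_nsmul _ _ (B.indicator 1 ω +
        ENNReal.ofReal (2 * (2 ^ k * a) + 2 * φ ^ 2)) fun i hi => ?_).trans (le_of_eq (by
          rw [Finset.card_range, nsmul_eq_mul]))
      have hik := Finset.mem_range.1 hi
      by_cases hω : ω ∈ B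
      · refine le_add_right ?_
        rw [Set.indicator_of_mem hω]
        have h1 := occupancy_mem_Icc (X s ω) (i + 1)
        have h2 := hq (i + 1) s hsT
        rw [Pi.one_apply, ENNReal.ofReal_le_one, sq_le_one_iff_abs_le_one]
        exact abs_le.2 ⟨by linarith [h1.1, h2.2], by linarith [h1.2, h2.1]⟩
      · refine le_add_left (ENNReal.ofReal_le_ofReal ?_)
        have h1 : lyapunov E L (fun i => q i s) (X s ω) ≤ a := by
          by_contra hcon
          exact hω (subset_toMeasurable _ _ ⟨s, hsT, not_le.1 hcon⟩)
        have h2 := sq_occupancy_sub_le hφ0 hφ (i + 1) (X s ω) (q (i + 1) s)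
        have h3 := meanSqDev_le_lyapunov E (hik.trans_le hkL) (fun i => q i s) (X s ω)
        have h4 : (2 : ℝ) ^ (i + 1) * lyapunov E L (fun i => q i s) (X s ω) ≤ 2 ^ k * a := by
          refine mul_le_mul (pow_le_pow_right₀ one_le_two hik) h1 (lyapunov_nonneg _ _ _ _)
            (by positivity)
        linarith
    · rw [invSqTail, ← ENNReal.tsum_mul_right]
      refine ENNReal.tsum_le_tsum fun i => ?_
      set j := i + k with hj
      have h1 : (occupancy (X s ω) (j + 1) - q (j + 1) s) ^ 2 ≤
          1 / ((j : ℝ) + 1) ^ 2 * (2 * load (X s ω) ^ 2 + 2 * A ^ 2) := by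
        have e1 := occupancy_succ_le (X s ω) j
        have e2 := hA j s hsT
        have e3 := (occupancy_mem_Icc (X s ω) (j + 1)).1
        have e4 := (hq (j + 1) s hsT).1
        have e5 := pow_le_pow_left₀ e3 e1 2
        have e6 := pow_le_pow_left₀ e4 e2 2
        rw [div_pow] at e5 e6
        have e7 : 1 / ((j : ℝ) + 1) ^ 2 * (2 * load (X s ω) ^ 2 + 2 * A ^ 2) =
          2 * (load (X s ω) ^ 2 / ((j : ℝ) + 1) ^ 2) + 2 * (A ^ 2 / ((j : ℝ) + 1) ^ 2) := by ring
        rw [e7]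
        nlinarith [sq_nonneg (occupancy (X s ω) (j + 1) + q (j + 1) s)]
      refine (ENNReal.ofReal_le_ofReal h1).trans ?_
      rw [ENNReal.ofReal_mul (by positivity)]
      refine mul_le_mul_right ?_ _
      rw [ENNReal.ofReal_add (by positivity) (by positivity)]
      refine add_le_add_left ?_ _
      rw [ENNReal.ofReal_mul (by norm_num)]
      calc ENNReal.ofReal 2 * ENNReal.ofReal (load (X s ω) ^ 2)
          ≤ ENNReal.ofReal 2 * (8 * (1 + G ω)) := by gcongr; exact hG ω s hsT
        _ = 16 * (1 + G ω) := by
          rw [← mul_assoc]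
          congr 1
          norm_num
  refine (lintegral_mono hpt).trans ?_
  have hind : Measurable fun ω => (k : ℝ≥0∞) * B.indicator 1 ω :=
    (measurable_one.indicator hBm).const_mul _
  rw [lintegral_add_left (hind.add_const _), lintegral_add_left hind, lintegral_const_mul _
    (measurable_one.indicator hBm), lintegral_indicator_one hBm, hB, measure_toMeasurable,
    lintegral_const, measure_univ, mul_one, lintegral_const_mul _ (by fun_prop),
    lintegral_add_right _ measurable_const, lintegral_const_mul _ (by fun_prop),
    lintegral_add_left measurable_const, lintegral_const, lintegral_const, measure_univ, mul_one,
    mul_one]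
  gcongr

/-- When the deviation probabilities are small, the fluid limit inherits the decay of the
occupancies. -/
lemma le_log_div_add_of_measure_lt_one [IsProbabilityMeasure P] [Nonempty V] [Nonempty W]
    {E : Set (V × W)} {φ : ℝ} (hφ0 : 0 ≤ φ) (hφ : ∀ v, |serverWeight E v - 1| ≤ φ)
    {q : ℕ → ℝ → ℝ} {X : ℝ≥0 → Ω → V → ℕ} {T : ℝ≥0} {L j : ℕ} (hj : j < L) {a b : ℝ}
    (hb : 0 < b) (hsmall : P {ω | ∃ s ≤ T, a < lyapunov E L (fun i => q i s) (X s ω)} +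
      P {ω | ∃ s ≤ T, b < Real.exp (load (X s ω))} < 1) {s : ℝ≥0} (hs : s ≤ T) :
    q (j + 1) s ≤ Real.log b / (j + 1) + √(2 * (2 ^ (j + 1) * a) + 2 * φ ^ 2) := by
  -- The quantity to be bounded is deterministic, so a single outcome outside both bad events
  -- suffices.
  obtain ⟨ω, hω⟩ : ∃ ω, ω ∉ {ω | ∃ s ≤ T, a < lyapunov E L (fun i => q i s) (X s ω)} ∪
      {ω | ∃ s ≤ T, b < Real.exp (load (X s ω))} := by
    by_contra hcon
    push Not at hcon
    have h1 := (measure_union_le _ _).trans_lt hsmall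
    rw [Set.eq_univ_of_forall hcon, measure_univ] at h1
    exact lt_irrefl _ h1
  have h1 : lyapunov E L (fun i => q i s) (X s ω) ≤ a := by
    by_contra hcon
    exact hω (Or.inl ⟨s, hs, not_le.1 hcon⟩)
  have h2 : Real.exp (load (X s ω)) ≤ b := by
    by_contra hcon
    exact hω (Or.inr ⟨s, hs, not_le.1 hcon⟩)
  have h3 := sq_occupancy_sub_le hφ0 hφ (j + 1) (X s ω) (q (j + 1) s)
  have h4 := meanSqDev_le_lyapunov E hj (fun i => q i s) (X s ω)
  have h5 := mul_le_mul_of_nonneg_left h1 (by positivity : (0 : ℝ) ≤ 2 ^ (j + 1))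
  have h6 := Real.abs_le_sqrt (h3.trans (by linarith :
    _ ≤ 2 * (2 ^ (j + 1) * a) + 2 * φ ^ 2))
  have h7 := occupancy_succ_le (X s ω) j
  have h8 : load (X s ω) / (j + 1) ≤ Real.log b / (j + 1) :=
    div_le_div_of_nonneg_right ((Real.le_log_iff_exp_le hb).2 h2) (by positivity)
  have h9 := (abs_le.1 h6).1
  linarith

end Bound

/-! ### Choice of parameters and the limit. -/

lemma eq_zero_of_occupancy_one {V : Type*} [Fintype V] [Nonempty V] {x : V → ℕ}
    (h : occupancy x 1 = 0) : x = 0 := by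
  classical
  have h1 : (Fintype.card V : ℝ) ≠ 0 := by exact_mod_cast Fintype.card_ne_zero
  have h2 := (div_eq_zero_iff.1 h).resolve_right h1
  have h3 : (Finset.univ.filter fun v => 1 ≤ x v) = ∅ := by
    rw [← Finset.card_eq_zero]
    exact_mod_cast h2
  funext v
  have h4 := Finset.filter_eq_empty_iff.1 h3 (Finset.mem_univ v)
  simp only [Pi.zero_apply]
  omega

theorem mainTheorem8 (lam ρ₀ : ℝ) (hlam0 : 0 < lam) (hlam1 : lam < 1) (d : ℕ) (hd : 2 ≤ d)
    -- the graphs `G_N = (V_N, W_N, E_N)`, `N ≥ 1`, with `N` servers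
    (V W : ℕ → Type*) [∀ N, Fintype (V N)] [∀ N, Fintype (W N)]
    (E : ∀ N, Set (V N × W N))
    (hV : ∀ N, 1 ≤ N → Fintype.card (V N) = N)
    (hW : ∀ N, 1 ≤ N → Nonempty (W N))
    (hdeg : ∀ N, 1 ≤ N → ∀ w, 1 ≤ typeDeg (E N) w)
    (hρ : ∀ N, 1 ≤ N → graphRho lam (E N) ≤ ρ₀)
    (hφγ : Tendsto (fun N => max (graphPhi (E N)) (graphGamma (E N))) atTop (𝓝 0))
    -- the queue length processes, started from the empty state
    (Ω : ℕ → Type*) [∀ N, MeasurableSpace (Ω N)] (P : ∀ N, Measure (Ω N))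
    [∀ N, IsProbabilityMeasure (P N)]
    (X : ∀ N, ℝ≥0 → Ω N → V N → ℕ)
    (hX : ∀ N, 1 ≤ N → IsQueueLengthProcess (P N) lam (E N) d (X N))
    (hX0 : ∀ N, 1 ≤ N → ∀ᵐ ω ∂(P N), occupancy (X N 0 ω) 1 = 0) :
    ∃ qbar : ℕ → ℝ → ℝ, IsFluidSolution lam d qbar ∧
      (∀ p, IsFluidSolution lam d p → ∀ i t, 0 ≤ t → p i t = qbar i t) ∧
      ∀ t : ℝ≥0, Tendsto
        (fun N => ∫⁻ ω, ⨆ s : Set.Icc (0 : ℝ≥0) t,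
          ∑' i : ℕ, ENNReal.ofReal
            ((occupancy (X N s ω) (i + 1) - qbar (i + 1) ((s : ℝ≥0) : ℝ)) ^ 2) ∂(P N))
        atTop (𝓝 0) := by
  have hd0 : d ≠ 0 := by omega
  have hlam := hlam0.le
  obtain ⟨q, hq⟩ := exists_isFluidSolution hlam hd0
  refine ⟨q, hq, fun p hp i t ht => (hp.upTo t).unique hlam (hq.upTo t) i ⟨ht, le_rfl⟩, fun T => ?_⟩
  have hVne : ∀ N, 1 ≤ N → Nonempty (V N) := fun N hN =>
    Fintype.card_pos_iff.1 (by rw [hV N hN]; omega)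
  set φ : ℕ → ℝ := fun N => graphPhi (E N) with hφdef
  set γ : ℕ → ℝ := fun N => graphGamma (E N) with hγdef
  have hφ0 : ∀ N, 0 ≤ φ N := fun N => Real.iSup_nonneg fun _ => abs_nonneg _
  have hγ0 : ∀ N, 0 ≤ γ N := fun N => graphGamma_nonneg _
  have hφt : Tendsto φ atTop (𝓝 0) :=
    squeeze_zero hφ0 (fun N => le_max_left _ _) hφγ
  have hγt : Tendsto γ atTop (𝓝 0) :=
    squeeze_zero hγ0 (fun N => le_max_right _ _) hφγ
  have hφ : ∀ N v, |serverWeight (E N) v - 1| ≤ φ N := fun N v =>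
    le_ciSup (f := fun v => |serverWeight (E N) v - 1|) (Set.finite_range _).bddAbove v
  set ρ : ℝ := ρ₀ / lam with hρdef
  have hρ' : ∀ N, 1 ≤ N → ∀ v, serverWeight (E N) v ≤ ρ := fun N hN v => by
    rw [hρdef, le_div_iff₀ hlam0, mul_comm]
    exact (le_ciSup (f := fun v => lam * serverWeight (E N) v)
      (Set.finite_range _).bddAbove v).trans (hρ N hN)
  have hρ0 : 0 ≤ ρ := by
    obtain ⟨v⟩ := hVne 1 le_rfl
    exact le_trans (by unfold serverWeight; positivity) (hρ' 1 le_rfl v)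
  have hX0' : ∀ N, 1 ≤ N → ∀ᵐ ω ∂(P N), X N 0 ω = 0 := fun N hN => by
    have := hVne N hN
    filter_upwards [hX0 N hN] with ω hω using eq_zero_of_occupancy_one hω
  set K : ℝ := Real.exp (2 * (lam * d * ρ) * T) with hKdef
  have hload : ∀ N, 1 ≤ N → ∀ a : ℝ, 0 < a →
      P N {ω | ∃ s ≤ T, a < Real.exp (load (X N s ω))} ≤ ENNReal.ofReal (K / a) :=
    fun N hN a ha => by
      have := hVne N hN
      exact measure_exists_lt_exp_load_le hlam hd0 (hρ' N hN) (hX N hN) (hX0' N hN) T ha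
  -- The truncation level is `L = N`, so that `2^{-L}` also vanishes in the limit.
  set ε : ℕ → ℝ := fun N => driftError lam ρ d (φ N) (γ N) N with hεdef
  have hκ0 : 0 < growthRate lam ρ d := by unfold growthRate; positivity
  have hε0 : ∀ N, 0 < ε N := fun N => by
    have := hφ0 N
    have := hγ0 N
    simp only [hεdef, driftError]
    positivity
  have hεt : Tendsto ε atTop (𝓝 0) := by
    have h1 : Tendsto (fun N : ℕ => (1 / 2 : ℝ) ^ N) atTop (𝓝 0) :=
      tendsto_pow_atTop_nhds_zero_of_lt_one (by norm_num) (by norm_num)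
    have h2 := (h1.const_mul (growthRate lam ρ d)).add
      ((hφt.const_mul (2 * lam * d)).add (hγt.const_mul (lam * d * ρ + 1)))
    simpa [hεdef, driftError] using h2
  -- With this threshold both `a` and the deviation probability bound `ε D / a = a D` tend to 0.
  set a : ℕ → ℝ := fun N => √(ε N) with hadef
  have ha0 : ∀ N, 0 < a N := fun N => Real.sqrt_pos.2 (hε0 N)
  have hat : Tendsto a atTop (𝓝 0) := by
    have := (Real.continuous_sqrt.tendsto 0).comp hεt
    simpa [hadef, Function.comp_def] using this
  set D : ℝ := T * Real.exp (growthRate lam ρ d * T) with hDdef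
  have hlyap : ∀ N, 1 ≤ N →
      P N {ω | ∃ s ≤ T, a N < lyapunov (E N) N (fun i => q i s) (X N s ω)} ≤
        ENNReal.ofReal (a N * D) := fun N hN => by
    have := hW N hN
    refine (measure_exists_lt_lyapunov_le hlam hd0 (hdeg N hN) (hφ0 N) hρ0 (hρ' N hN) (hφ N) hq
      (hX N hN) (hX0' N hN) N T (ha0 N)).trans (ENNReal.ofReal_le_ofReal (le_of_eq ?_))
    have h1 : driftError lam ρ d (φ N) (graphGamma (E N)) N = a N * a N :=
      (Real.mul_self_sqrt (hε0 N).le).symm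
    rw [h1, hDdef]
    have := (ha0 N).ne'
    field_simp
  have haD : Tendsto (fun N => ENNReal.ofReal (a N * D)) atTop (𝓝 0) := by
    have := ENNReal.tendsto_ofReal (hat.mul_const D)
    simpa using this
  -- The load exceeds `log (4 K)` with probability at most `1/4`. Together with a deviation
  -- probability below `1/2` this leaves good outcomes, and letting `N → ∞` gives the decay `A / (j
  -- + 1)` of the fluid solution.
  set A : ℝ := Real.log (4 * K) with hAdef
  have hK0 : 0 < K := Real.exp_pos _
  have hA : ∀ j : ℕ, ∀ s ≤ T, q (j + 1) (s : ℝ≥0) ≤ A / (j + 1) := by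
    intro j s hs
    have hlim : Tendsto (fun N => A / (j + 1) + √(2 * (2 ^ (j + 1) * a N) + 2 * φ N ^ 2)) atTop
        (𝓝 (A / (j + 1))) := by
      have h1 := ((hat.const_mul (2 ^ (j + 1))).const_mul 2).add ((hφt.pow 2).const_mul 2)
      have h2 := ((Real.continuous_sqrt.tendsto _).comp h1).const_add (A / (j + 1))
      simpa using h2
    refine ge_of_tendsto hlim ?_
    filter_upwards [eventually_gt_atTop j, eventually_ge_atTop 1,
      haD.eventually (gt_mem_nhds (show (0 : ℝ≥0∞) < 1 / 2 by norm_num))] with N hNj hN hNs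
    have := hVne N hN
    have := hW N hN
    refine le_log_div_add_of_measure_lt_one (P := P N) (X := X N) (hφ0 N) (hφ N) hNj
      (by positivity) ?_ hs
    have h1 : P N {ω | ∃ s ≤ T, 4 * K < Real.exp (load (X N s ω))} ≤ 1 / 2 := by
      refine (hload N hN (4 * K) (by positivity)).trans ?_
      have h2 : K / (4 * K) = 1 / 4 := by field_simp
      rw [h2, show (1 / 2 : ℝ≥0∞) = ENNReal.ofReal (1 / 2) by
        rw [ENNReal.ofReal_div_of_pos two_pos]; simp]
      exact ENNReal.ofReal_le_ofReal (by norm_num)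
    calc _ < 1 / 2 + 1 / 2 := ENNReal.add_lt_add_of_lt_of_le (ne_top_of_le_ne_top (by simp) h1)
          ((hlyap N hN).trans_lt hNs) h1
      _ = 1 := ENNReal.add_halves 1
  set M : ℝ≥0∞ := 16 * (1 + ENNReal.ofReal K * invSqTail 0) + ENNReal.ofReal (2 * A ^ 2) with hMdef
  have hM : M ≠ ∞ := by
    rw [hMdef]
    exact ENNReal.add_ne_top.2 ⟨ENNReal.mul_ne_top (by simp) (ENNReal.add_ne_top.2 ⟨by simp,
      ENNReal.mul_ne_top (by simp) invSqTail_zero_ne_top⟩), ENNReal.ofReal_ne_top⟩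
  have hbound : ∀ k N : ℕ, k ≤ N → 1 ≤ N →
      ∫⁻ ω, ⨆ s : Set.Icc (0 : ℝ≥0) T, ∑' i : ℕ, ENNReal.ofReal
          ((occupancy (X N s ω) (i + 1) - q (i + 1) ((s : ℝ≥0) : ℝ)) ^ 2) ∂(P N) ≤
        (k * ENNReal.ofReal (a N * D) +
          k * ENNReal.ofReal (2 * (2 ^ k * a N) + 2 * φ N ^ 2)) + invSqTail k * M := by
    intro k N hk hN
    have := hVne N hN
    have := hW N hN
    refine (lintegral_iSup_sq_le (hφ0 N) (hφ N) (fun i s _ => hq.mem_Icc i s s.2) hA hK0.le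
      (hload N hN) hk (a := a N)).trans ?_
    gcongr
    exact hlyap N hN
  refine ENNReal.tendsto_nhds_zero.2 fun η hη => ?_
  have hη2 : 0 < η / 2 := ENNReal.half_pos hη.ne'
  have htail : Tendsto (fun k => invSqTail k * M) atTop (𝓝 0) := by
    simpa using ENNReal.Tendsto.mul_const tendsto_invSqTail (Or.inr hM)
  -- The number of levels `k` is fixed before `N → ∞`, because the bound on the first `k` levels
  -- carries the factor `2 ^ k`.
  obtain ⟨k, hk⟩ := (htail.eventually (ge_mem_nhds hη2)).exists
  have hmain : Tendsto (fun N => (k : ℝ≥0∞) * ENNReal.ofReal (a N * D) +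
      k * ENNReal.ofReal (2 * (2 ^ k * a N) + 2 * φ N ^ 2)) atTop (𝓝 0) := by
    have h1 := ENNReal.tendsto_ofReal
      (((hat.const_mul (2 ^ k)).const_mul 2).add ((hφt.pow 2).const_mul 2))
    have h2 := (ENNReal.Tendsto.const_mul haD (Or.inr (ENNReal.natCast_ne_top k))).add
      (ENNReal.Tendsto.const_mul h1 (Or.inr (ENNReal.natCast_ne_top k)))
    simpa using h2
  filter_upwards [hmain.eventually (ge_mem_nhds hη2), eventually_ge_atTop k,
    eventually_ge_atTop 1] with N hN hkN hN1
  calc _ ≤ _ := hbound k N hkN hN1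
    _ ≤ η / 2 + η / 2 := add_le_add hN hk
    _ = η := ENNReal.add_halves η
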